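/- Consider the following game. You start with $n$ coins, each of which lands heads with probability $p$, independently. You toss all of them and then set aside at least one coin of your choice; coins set aside are not tossed again. You repeat this with the remaining coins until all coins have been set aside. A strategy may depend on everything seen so far, and it is optimal if it maximizes the expected total number of heads among the coins set aside. Let $v_{n,p}$ be the expected number of heads under optimal play from $n$ coins, and put $s_n(p) = v_{n,p} - n + 1 - p$. Consider the following two strategies for a round in which $n$ coins are tossed and $j$ of them show heads. A. Set aside exactly one coin (one showing heads if $j \ge 1$), unless $j = n$, in which case all coins are set aside. B. Set aside exactly one coin (one showing heads if $j \ge 1$), unless $j = n$ or $j = n-1$; in both of these cases all heads are set aside. (With one or two remaining coins A and B are both read as: take everything if all coins show heads, and otherwise set aside exactly one coin, one showing heads if there is one.) **Theorem.** For every $p$ with $\frac12 \le p < 1$ and every number $n \ge 3$ of remaining coins, it is optimal to make the decision in the present round according to A, or it is optimal to make it according to B. Moreover, let $\phi = \frac{\sqrt5 - 1}{2}$. The limit $s(p) = \lim_{n\to\infty} s_n(p)$ exists for all $p \in [\frac12, 1)$, and there is a constant $p_0$ with $|p_0 - 0.5495021777642| < 10^{-14}$ such that $s$ is differentiable at $p_0$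 with $s'(p_0) > 0$, and such that the following hold. 1. For $\phi \le p < 1$ and every $n \ge 3$, starting from $n$ coins, it is optimal to follow strategy A in every round. 2. For $p_0 < p < \phi$ there is an integer $n(p) \ge 3$ such that, starting from any number $\ge 3$ of coins, it is optimal to follow strategy A in every round with more than $n(p)$ remaining coins and strategy B in every round with at most $n(p)$ remaining coins; and for $3 \le n \le n(p)$ remaining coins it is not optimal to decide according to A. Moreover $$n(p) = \left\lfloor \frac{\log(p-p_0) + \log s'(p_0)}{\log p_0} + o(1) \right\rfloor ,$$ where $o(1)$ is a quantity depending on $p$ that converges to $0$ as $p$ converges to $p_0$ from above; and $n(p) \to \infty$ as $p$ converges to $p_0$ from above. 3. For $\frac12 \le p \le p_0$ and every $n \ge 3$, starting from $n$ coins, it is optimal to follow strategy B in every round. -/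

import Mathlib

open Filter Topology

namespace CoinGame

/-- A (complete, history-dependent) strategy for the game with `n` remaining coins, labelled by
`Fin n`.  With no coins left there is nothing to do.  With `n + 1` coins left, all of them are
tossed; when `H` is the set of coins that landed heads, the player sets aside the nonempty set
`aside H` of coins, and then plays on with the remaining coins (relabelled, which is harmless as
the coins are independent and identically distributed), using the strategy `next H`, which may
depend on everything that has been seen so far. -/
inductive Strategy : ℕ → Type
  | done : Strategy 0
  | toss (n : ℕ) (aside : Finset (Fin (n + 1)) → Finset (Fin (n + 1)))
      (aside_nonempty : ∀ H, (aside H).Nonempty)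
      (next : ∀ H, Strategy (n + 1 - (aside H).card)) : Strategy (n + 1)

/-- The expected total number of heads that are set aside, when each tossed coin independently
lands heads with probability `p`: the set of heads equals `H` with probability
`p ^ |H| * (1 - p) ^ |Hᶜ|`. -/
noncomputable def Strategy.payoff (p : ℝ) : {n : ℕ} → Strategy n → ℝ
  | _, .done => 0
  | _, .toss n aside _ next =>
      ∑ H : Finset (Fin (n + 1)), p ^ H.card * (1 - p) ^ Hᶜ.card *
        (((aside H ∩ H).card : ℝ) + (next H).payoff p)

/-- A strategy is optimal if no strategy for the same number of coins has a larger expected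
payoff. -/
def Strategy.IsOptimal (p : ℝ) {n : ℕ} (σ : Strategy n) : Prop :=
  ∀ τ : Strategy n, τ.payoff p ≤ σ.payoff p

/-- `value n p` is the expected number of heads obtained with optimal play from `n` coins. -/
noncomputable def value (n : ℕ) (p : ℝ) : ℝ :=
  ⨆ σ : Strategy n, σ.payoff p

/-- `s_n(p) = v_{n,p} - n + 1 - p`. -/
noncomputable def sSeq (n : ℕ) (p : ℝ) : ℝ :=
  value n p - n + 1 - p

/-- A rule for one round: `R n H D` says that, when `n` coins were tossed and `H` is the set of
those that landed heads, the rule allows the player to set aside exactly the coins in `D`. -/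
abbrev Rule : Type := (n : ℕ) → Finset (Fin n) → Finset (Fin n) → Prop

/-- Set aside exactly one coin, one that shows heads if there is any. -/
def takeOne : Rule := fun _ H D =>
  D.card = 1 ∧ (H.Nonempty → D ⊆ H)

/-- Strategy A: set aside exactly one coin, unless all `n` coins show heads, in which case all of
them are taken. -/
def ruleA : Rule := fun n H D =>
  if H.card = n then D = H else takeOne n H D

/-- Strategy B: set aside exactly one coin, unless `n` or `n - 1` of the `n` coins show heads, in
which cases all heads are taken.  (The requirement that `H` is nonempty matters only for `n = 1`:
a single coin that shows tails has to be set aside.) -/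
def ruleB : Rule := fun n H D =>
  if H.Nonempty ∧ (H.card = n ∨ H.card + 1 = n) then D = H else takeOne n H D

/-- Use strategy A in the rounds with more than `N` remaining coins, and strategy B in the rounds
with at most `N` remaining coins. -/
def switchRule (N : ℕ) : Rule := fun n H D =>
  if N < n then ruleA n H D else ruleB n H D

/-- The decisions of `σ` in its first round obey the rule `R`, whatever the toss shows. -/
def Strategy.FirstRoundObeys (R : Rule) : {n : ℕ} → Strategy n → Prop
  | _, .done => True
  | _, .toss n aside _ _ => ∀ H, R (n + 1) H (aside H)

/-- The decisions of `σ` obey the rule `R` in every round. -/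
def Strategy.Follows (R : Rule) : {n : ℕ} → Strategy n → Prop
  | _, .done => True
  | _, .toss n aside _ next => ∀ H, R (n + 1) H (aside H) ∧ (next H).Follows R

/-- With `n` remaining coins, it is optimal to let the decision in the present round be made
according to `R`. -/
def OptimalDecision (p : ℝ) (n : ℕ) (R : Rule) : Prop :=
  ∃ σ : Strategy n, σ.FirstRoundObeys R ∧ σ.IsOptimal p

/-- Starting with `n` coins, it is optimal to follow the rule `R` in every round: this can be done,
and every way of doing so is an optimal strategy. -/
def OptimalToFollow (p : ℝ) (n : ℕ) (R : Rule) : Prop :=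
  (∃ σ : Strategy n, σ.Follows R) ∧ ∀ σ : Strategy n, σ.Follows R → σ.IsOptimal p

end CoinGame

open Filter Topology

namespace CoinGame

/-! Measure the value of n coins against the benchmark n - (1-p); the difference is `excess`.
Setting aside a head then costs nothing, a tail costs 1, and a single coin has excess 0. From two
coins on the excesses do not decrease (here p ≥ 1/2 enters), and all lie in [-p, 1-p], an interval
of length 1. So no tail should be set aside unless there are only tails, and as few coins as
possible should go, except when all coins show heads, or all but one: then keeping a single coin, of
excess 0, competes with the excess of one coin fewer (`le_best`). Hence with n + 1 coins A is right
if `excess p n` is ≥ 0 and B if it is ≤ 0, and by monotonicity the sign changes at most once.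

For two coins the sign is that of p² + p - 1, which produces φ. While the values stay nonpositive
they follow the linear recursion `linSeq`, whose terms are polynomials in p. Each term is
nondecreasing in p as long as the earlier ones are nonpositive, so the p for which all are
nonpositive form an interval; its right end `threshold` is p₀, and exact integer arithmetic locates
it.

Near p₀ the derivatives of the `linSeq` terms converge uniformly, at p₀ to some c ≥ 1/5. The limit s
vanishes at p₀, and -`linSeq` p₀ k is asymptotic to p₀^(k+2). For p slightly above p₀ the sign
changes where c(p-p₀) overtakes p₀^(k+2); logarithms give n(p). Beyond the sign change the optimal
and the linear recursion differ by o(p-p₀) only, so c is indeed s'(p₀). -/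

/-! ### Monotonicity and bounds for the normalized values -/

/-- The probability that at least `m - 1` of `m` coins land heads. -/
noncomputable def almostAll (p : ℝ) (m : ℕ) : ℝ := p ^ m + m * p ^ (m - 1) * (1 - p)

lemma almostAll_succ (p : ℝ) (m : ℕ) :
    almostAll p (m + 1) = p ^ (m + 1) + (m + 1) * p ^ m * (1 - p) := by
  simp [almostAll]

lemma almostAll_step (p : ℝ) (m : ℕ) :
    almostAll p (m + 1) = almostAll p m - m * p ^ (m - 1) * (1 - p) ^ 2 := by
  cases m with
  | zero => simp [almostAll]
  | succ k => simp only [almostAll, Nat.add_sub_cancel]; push_cast; ring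

lemma almostAll_nonneg {p : ℝ} (h0 : 0 ≤ p) (h1 : p ≤ 1) (m : ℕ) : 0 ≤ almostAll p m := by
  have : 0 ≤ 1 - p := by linarith
  unfold almostAll; positivity

lemma almostAll_le_one {p : ℝ} (h0 : 0 ≤ p) (m : ℕ) : almostAll p m ≤ 1 := by
  induction m with
  | zero => simp [almostAll]
  | succ k ih =>
    rw [almostAll_step]
    have : 0 ≤ (k : ℝ) * p ^ (k - 1) * (1 - p) ^ 2 := by positivity
    linarith

/-- The increment of the normalized value when the number of coins grows from `k + 1` to `k + 2`
and the normalized value of `k + 1` coins is `x`. -/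
noncomputable def increment (p : ℝ) (k : ℕ) (x : ℝ) : ℝ :=
  p ^ (k + 2) * (1 - p - x) - (1 - p) ^ (k + 2) - (k + 2) * p ^ (k + 1) * (1 - p) * min x 0

/-- The normalized value of `k + 1` coins. -/
noncomputable def gameSeq (p : ℝ) : ℕ → ℝ
  | 0 => 0
  | k + 1 => gameSeq p k + increment p k (gameSeq p k)

/-- The normalized value of `n` coins. -/
noncomputable def excess (p : ℝ) : ℕ → ℝ
  | 0 => 1 - p
  | k + 1 => gameSeq p k

lemma gameSeq_one (p : ℝ) : gameSeq p 1 = (1 - p) * (p ^ 2 - (1 - p)) := by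
  simp [gameSeq, increment]; ring

/-- Since y ↦ min y 0 is nondecreasing and 1-Lipschitz, the same increment function at x + d is
still at least (1 - `almostAll p (k + 2)`) * d. Raising k by one multiplies by p and adds two terms,
the first nonnegative because 2p ≥ 1. -/
lemma increment_succ_nonneg {p : ℝ} (h1 : 1 / 2 ≤ p) (h2 : p < 1) {k : ℕ} {x : ℝ}
    (h : 0 ≤ increment p k x) : 0 ≤ increment p (k + 1) (x + increment p k x) := by
  have hq : 0 ≤ 1 - p := by linarith
  have hp : 0 ≤ p := by linarith
  generalize hd : increment p k x = d at *
  have hmin : min (x + d) 0 - min x 0 ≤ d := by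
    rcases min_cases (x + d) 0 with ⟨a, b⟩ | ⟨a, b⟩ <;>
      rcases min_cases x 0 with ⟨a', b'⟩ | ⟨a', b'⟩ <;>
      rw [a, a'] <;> linarith
  have hA := almostAll_le_one hp (k + 2)
  rw [almostAll_succ] at hA
  push_cast at hA
  have step1 : 0 ≤ increment p k (x + d) := by
    have e : increment p k (x + d) = d - p ^ (k + 2) * d
        - (k + 2) * p ^ (k + 1) * (1 - p) * (min (x + d) 0 - min x 0) := by
      rw [← hd]; simp only [increment]; ring
    have : (k + 2) * p ^ (k + 1) * (1 - p) * (min (x + d) 0 - min x 0)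
        ≤ (k + 2) * p ^ (k + 1) * (1 - p) * d := by gcongr
    rw [e]
    nlinarith
  have e2 : increment p (k + 1) (x + d) = p * increment p k (x + d)
      + (1 - p) ^ (k + 2) * (2 * p - 1) + p ^ (k + 2) * (1 - p) * (- min (x + d) 0) := by
    simp only [increment]; push_cast; ring
  rw [e2]
  have : 0 ≤ - min (x + d) 0 := by simp
  have : 0 ≤ 2 * p - 1 := by linarith
  positivity

/-- The induction has to start here: for p < φ the sequence first drops from 0 to a negative value.
-/
lemma increment_gameSeq_one_nonneg {p : ℝ} (h1 : 1 / 2 ≤ p) (h2 : p < 1) :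
    0 ≤ increment p 1 (gameSeq p 1) := by
  have hq : 0 < 1 - p := by linarith
  rw [gameSeq_one]
  simp only [increment]
  rcases le_total 0 (p ^ 2 - (1 - p)) with h | h
  · rw [min_eq_right (by positivity)]
    have : p ^ (1 + 2) * (1 - p - (1 - p) * (p ^ 2 - (1 - p))) - (1 - p) ^ (1 + 2)
        - ((1 : ℕ) + 2) * p ^ (1 + 1) * (1 - p) * 0
        = (1 - p) * (p ^ 3 * (1 - p) * (2 + p) - (1 - p) ^ 2) := by push_cast; ring
    rw [this]
    apply mul_nonneg hq.le
    have : p ^ 3 * (1 - p) * (2 + p) - (1 - p) ^ 2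
      = (1 - p) * (p ^ 3 * (2 + p) - (1 - p)) := by ring
    rw [this]
    apply mul_nonneg hq.le
    nlinarith [mul_nonneg (sq_nonneg p) (show 0 ≤ p * (2 + p) - 1 by nlinarith)]
  · rw [min_eq_left (mul_nonpos_of_nonneg_of_nonpos hq.le h)]
    have : p ^ (1 + 2) * (1 - p - (1 - p) * (p ^ 2 - (1 - p))) - (1 - p) ^ (1 + 2)
        - ((1 : ℕ) + 2) * p ^ (1 + 1) * (1 - p) * ((1 - p) * (p ^ 2 - (1 - p)))
        = (1 - p) * (p ^ 3 - (1 - p) ^ 2 + p ^ 2 * (3 - 2 * p) * (1 - p - p ^ 2)) := by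
      push_cast; ring
    rw [this]
    apply mul_nonneg hq.le
    have h3 : 0 ≤ (2 * p - 1) * (1 - p - p ^ 2) := mul_nonneg (by linarith) (by linarith)
    have h4 : 0 ≤ 1 - p - p ^ 2 := by linarith
    nlinarith [mul_nonneg h3 hq.le, mul_nonneg h3 (sq_nonneg p)]

lemma increment_gameSeq_nonneg {p : ℝ} (h1 : 1 / 2 ≤ p) (h2 : p < 1) (k : ℕ) :
    0 ≤ increment p (k + 1) (gameSeq p (k + 1)) := by
  induction k with
  | zero => exact increment_gameSeq_one_nonneg h1 h2
  | succ k ih => exact increment_succ_nonneg h1 h2 ih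

lemma gameSeq_le_succ {p : ℝ} (h1 : 1 / 2 ≤ p) (h2 : p < 1) (k : ℕ) :
    gameSeq p (k + 1) ≤ gameSeq p (k + 2) := by
  have := increment_gameSeq_nonneg h1 h2 k
  rw [show gameSeq p (k + 2) = gameSeq p (k + 1) + increment p (k + 1) (gameSeq p (k + 1)) from rfl]
  linarith

lemma gameSeq_mono {p : ℝ} (h1 : 1 / 2 ≤ p) (h2 : p < 1) :
    Monotone (fun k => gameSeq p (k + 1)) :=
  monotone_nat_of_le_succ (gameSeq_le_succ h1 h2)

/-- The gain from the event of all heads but one is absorbed by the gap to 1 - p, because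
`almostAll` is at most 1. -/
lemma gameSeq_le {p : ℝ} (h1 : 1 / 2 ≤ p) (h2 : p < 1) (k : ℕ) : gameSeq p k ≤ 1 - p := by
  have hq : 0 ≤ 1 - p := by linarith
  have hp : 0 ≤ p := by linarith
  induction k with
  | zero => simpa [gameSeq] using h2.le
  | succ k ih =>
    have hA := almostAll_le_one hp (k + 2)
    have hA' : (k + 2) * p ^ (k + 1) * (1 - p) ≤ 1 - p ^ (k + 2) := by
      rw [almostAll_succ] at hA; push_cast at hA; linarith
    have hx : -min (gameSeq p k) 0 ≤ 1 - p - gameSeq p k := by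
      rcases min_cases (gameSeq p k) 0 with ⟨a, b⟩ | ⟨a, b⟩ <;> rw [a] <;> linarith
    have h0 : 0 ≤ -min (gameSeq p k) 0 := by simp
    have : (k + 2) * p ^ (k + 1) * (1 - p) * (-min (gameSeq p k) 0)
        ≤ (1 - p ^ (k + 2)) * (1 - p - gameSeq p k) := by
      apply mul_le_mul hA' hx h0
      linarith [pow_le_one₀ (n := k + 2) hp h2.le]
    have : 0 ≤ (1 - p) ^ (k + 2) := by positivity
    simp only [gameSeq, increment]
    linarith

lemma neg_le_gameSeq {p : ℝ} (h1 : 1 / 2 ≤ p) (h2 : p < 1) (k : ℕ) : -p ≤ gameSeq p k := by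
  cases k with
  | zero => simp [gameSeq]; linarith
  | succ k =>
    have := gameSeq_mono h1 h2 (Nat.zero_le k)
    simp only [zero_add, gameSeq_one] at this
    nlinarith [mul_nonneg (show 0 ≤ 1 - p by linarith) (sq_nonneg p)]

/-! ### One round, and optimality of the rules -/

/-- The best normalized continuation value when `j` of `n + 1` tossed coins show heads. -/
noncomputable def best (p : ℝ) (n j : ℕ) : ℝ :=
  if j = n + 1 then 1 - p
  else if j = 0 then excess p n - 1
  else if j = n then max (excess p n) 0
  else excess p n

/-- If only heads are set aside, monotonicity favours leaving as many coins as possible; leaving one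
coin or none needs at least n heads. A tail costs 1, which no difference of two excesses in [-p,
1-p] can repay. -/
lemma le_best {p : ℝ} (h1 : 1 / 2 ≤ p) (h2 : p < 1) (n : ℕ) (H D : Finset (Fin (n + 1)))
    (hD : D.Nonempty) :
    excess p (n + 1 - D.card) - (D \ H).card ≤ best p n H.card := by
  have hDc : D.card ≤ n + 1 := by simpa using D.card_le_univ
  have hD1 : 1 ≤ D.card := hD.card_pos
  have hle : ∀ m, excess p m ≤ 1 - p := by
    intro m
    cases m with
    | zero => exact le_rfl
    | succ k => exact gameSeq_le h1 h2 k
  have hge : ∀ m, -p ≤ excess p m := by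
    intro m
    cases m with
    | zero => simp [excess]
    | succ k => exact neg_le_gameSeq h1 h2 k
  have hmono : ∀ m, 2 ≤ m → m ≤ n → excess p m ≤ excess p n := by
    intro m hm hmn
    obtain ⟨a, rfl⟩ := Nat.exists_eq_add_of_le hm
    obtain ⟨b, rfl⟩ := Nat.exists_eq_add_of_le hmn
    have := gameSeq_mono h1 h2 (Nat.le_add_right a b)
    simp only at this
    rw [show 2 + a = a + 1 + 1 by ring, show a + 1 + 1 + b = a + b + 1 + 1 by ring]
    exact this
  rcases Nat.eq_zero_or_pos (D \ H).card with h0 | h0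
  · have hsub : D ⊆ H := by simpa [Finset.sdiff_eq_empty_iff_subset] using h0
    have hDH := Finset.card_le_card hsub
    have hHc : H.card ≤ n + 1 := by simpa using H.card_le_univ
    rw [h0]
    simp only [best, Nat.cast_zero, sub_zero]
    split_ifs with c1 c2 c3
    · exact hle _
    · omega
    -- With fewer than two coins left all n heads were taken, and the remaining coin has excess 0.
    · rcases Nat.lt_or_ge (n + 1 - D.card) 2 with hs | hs
      · rw [show n + 1 - D.card = 1 by omega]
        exact le_max_right _ _
      · exact (hmono _ hs (by omega)).trans (le_max_left _ _)
    · exact hmono _ (by omega) (by omega)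
  · have hc : (1 : ℝ) ≤ (D \ H).card := by exact_mod_cast h0
    have a1 := hle (n + 1 - D.card)
    have a2 := hge n
    simp only [best]
    split_ifs with c1 c2 c3
    · linarith
    · have hH : H = ∅ := Finset.card_eq_zero.mp c2
      subst hH
      rw [Finset.sdiff_empty] at *
      rcases Nat.lt_or_ge D.card 2 with hs | hs
      · have : D.card = 1 := by omega
        simp [this]
      · have : (2 : ℝ) ≤ D.card := by exact_mod_cast hs
        linarith
    · exact le_trans (by linarith) (le_max_left _ _)
    · linarith

/-- The probability that exactly the coins in `H` land heads. -/
noncomputable def prob (p : ℝ) {m : ℕ} (H : Finset (Fin m)) : ℝ :=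
  p ^ H.card * (1 - p) ^ Hᶜ.card

lemma sum_prob_card (p : ℝ) (m : ℕ) (f : ℕ → ℝ) :
    ∑ H : Finset (Fin m), prob p H * f H.card
      = ∑ j ∈ Finset.range (m + 1), (m.choose j) * (p ^ j * (1 - p) ^ (m - j) * f j) := by
  have := Finset.sum_powerset_apply_card (x := (Finset.univ : Finset (Fin m)))
    (fun j => p ^ j * (1 - p) ^ (m - j) * f j)
  simp only [Finset.powerset_univ, Finset.card_univ, Fintype.card_fin, nsmul_eq_mul] at this
  rw [← this]
  refine Finset.sum_congr rfl fun H _ => ?_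
  simp [prob, Finset.card_compl]

lemma sum_prob (p : ℝ) (m : ℕ) : ∑ H : Finset (Fin m), prob p H = 1 := by
  have h := sum_prob_card p m (fun _ => 1)
  simp only [mul_one] at h
  rw [h]
  have := add_pow p (1 - p) m
  rw [add_sub_cancel, one_pow] at this
  refine Eq.trans ?_ this.symm
  exact Finset.sum_congr rfl fun j _ => by ring

lemma prob_nonneg {p : ℝ} (h1 : 1 / 2 ≤ p) (h2 : p < 1) {m : ℕ} (H : Finset (Fin m)) :
    0 ≤ prob p H := by
  have : 0 ≤ 1 - p := by linarith
  have : 0 ≤ p := by linarith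
  unfold prob; positivity

/-- This is the Bellman equation: `best` equals `excess p n` up to corrections for all heads, no
heads and all heads but one, and their expectations make up `increment`. -/
lemma sum_best (p : ℝ) (n : ℕ) :
    ∑ H : Finset (Fin (n + 1)), prob p H * best p n H.card = excess p (n + 1) := by
  cases n with
  | zero =>
    rw [sum_prob_card]
    simp [Finset.sum_range_succ, best, excess, gameSeq]
    ring
  | succ k =>
    have hb : ∀ j, best p (k + 1) j = gameSeq p k
        + ((if j = k + 2 then (1 - p - gameSeq p k) else 0)
        + (if j = 0 then -1 else 0) + (if j = k + 1 then - min (gameSeq p k) 0 else 0)) := by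
      intro j
      have : max (gameSeq p k) 0 = gameSeq p k - min (gameSeq p k) 0 := by
        rcases le_total 0 (gameSeq p k) with h | h <;> simp [h]
      simp only [best, excess, this]
      split_ifs <;> first | omega | ring
    simp only [hb, mul_add, Finset.sum_add_distrib]
    rw [← Finset.sum_mul, sum_prob, sum_prob_card p _ (fun j => if j = k + 2 then _ else _),
      sum_prob_card p _ (fun j => if j = 0 then _ else _),
      sum_prob_card p _ (fun j => if j = k + 1 then _ else _)]
    simp only [mul_ite, mul_zero, Finset.sum_ite_eq', Finset.mem_range]
    rw [if_pos (by omega), if_pos (by omega), if_pos (by omega)]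
    simp only [excess, gameSeq, increment, Nat.choose_self, Nat.choose_zero_right,
      Nat.choose_succ_self_right, Nat.sub_self, Nat.sub_zero]
    rw [show k + 1 + 1 - (k + 1) = 1 by omega]
    push_cast
    ring

/-- The expected number of heads under optimal play, as it results from `gameSeq`. -/
noncomputable def optimum (p : ℝ) (n : ℕ) : ℝ := n - (1 - p) + excess p n

lemma round_value (p : ℝ) (n : ℕ) (H D : Finset (Fin (n + 1))) :
    ((D ∩ H).card : ℝ) + optimum p (n + 1 - D.card)
      = n + 1 - (1 - p) + (excess p (n + 1 - D.card) - (D \ H).card) := by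
  have hDc : D.card ≤ n + 1 := by simpa using D.card_le_univ
  have : ((D \ H).card : ℝ) + (D ∩ H).card = D.card := by
    exact_mod_cast Finset.card_sdiff_add_card_inter D H
  simp only [optimum]
  rw [Nat.cast_sub hDc]
  push_cast
  linarith

lemma sum_round (p : ℝ) (n : ℕ) :
    ∑ H : Finset (Fin (n + 1)), prob p H * (n + 1 - (1 - p) + best p n H.card)
      = optimum p (n + 1) := by
  simp only [mul_add, Finset.sum_add_distrib]
  rw [sum_best, ← Finset.sum_mul, sum_prob, optimum]
  push_cast
  ring

lemma payoff_toss (p : ℝ) (n : ℕ) (aside h next) :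
    (Strategy.toss n aside h next).payoff p
      = ∑ H : Finset (Fin (n + 1)), prob p H *
        (((aside H ∩ H).card : ℝ) + (next H).payoff p) := rfl

lemma payoff_le {p : ℝ} (h1 : 1 / 2 ≤ p) (h2 : p < 1) {n : ℕ} (τ : Strategy n) :
    τ.payoff p ≤ optimum p n := by
  induction τ with
  | done => simp [Strategy.payoff, optimum, excess]
  | toss n aside h next ih =>
    rw [payoff_toss, ← sum_round]
    refine Finset.sum_le_sum fun H _ => mul_le_mul_of_nonneg_left ?_ (prob_nonneg h1 h2 H)
    have e := round_value p n H (aside H)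
    have := le_best h1 h2 n H (aside H) (h H)
    linarith [ih H]

/-- The decisions allowed by `R` with `n + 1` coins are possible and best. -/
def GoodAt (p : ℝ) (R : Rule) (n : ℕ) : Prop :=
  ∀ H : Finset (Fin (n + 1)), (∃ D, D.Nonempty ∧ R (n + 1) H D) ∧
    ∀ D, R (n + 1) H D → excess p (n + 1 - D.card) - (D \ H).card = best p n H.card

lemma payoff_eq_of_follows {p : ℝ} {R : Rule} (hR : ∀ n, GoodAt p R n) {n : ℕ} (τ : Strategy n)
    (hτ : τ.Follows R) : τ.payoff p = optimum p n := by
  induction τ with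
  | done => simp [Strategy.payoff, optimum, excess]
  | toss n aside h next ih =>
    rw [payoff_toss, ← sum_round]
    refine Finset.sum_congr rfl fun H _ => ?_
    have e := round_value p n H (aside H)
    have := (hR n H).2 _ (hτ H).1
    rw [ih H (hτ H).2, e, this]

lemma exists_follows {p : ℝ} {R : Rule} (hR : ∀ n, GoodAt p R n) (n : ℕ) :
    ∃ τ : Strategy n, τ.Follows R := by
  induction n using Nat.strong_induction_on with
  | _ n ih =>
    cases n with
    | zero => exact ⟨.done, trivial⟩
    | succ n =>
      choose D hD hD' using fun H => (hR n H).1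
      choose nx hnx using fun H : Finset (Fin (n + 1)) =>
        ih (n + 1 - (D H).card) (by have := (hD H).card_pos; omega)
      exact ⟨.toss n D hD nx, fun H => ⟨hD' H, hnx H⟩⟩

lemma firstRoundObeys_of_follows {R : Rule} {n : ℕ} {τ : Strategy n} (h : τ.Follows R) :
    τ.FirstRoundObeys R := by
  cases τ with
  | done => trivial
  | toss n aside h' next => exact fun H => (h H).1

lemma optimalToFollow_of_goodAt {p : ℝ} (h1 : 1 / 2 ≤ p) (h2 : p < 1) {R : Rule}
    (hR : ∀ n, GoodAt p R n) (n : ℕ) : OptimalToFollow p n R :=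
  ⟨exists_follows hR n, fun τ hτ τ' => by
    rw [payoff_eq_of_follows hR τ hτ]; exact payoff_le h1 h2 τ'⟩

lemma exists_takeOne (n : ℕ) (H : Finset (Fin (n + 1))) :
    ∃ D, D.Nonempty ∧ takeOne (n + 1) H D := by
  rcases H.eq_empty_or_nonempty with h | ⟨x, hx⟩
  · exact ⟨{0}, by simp, by simp [takeOne, h]⟩
  · exact ⟨{x}, by simp, by simp [takeOne, hx]⟩

lemma takeOne_value (p : ℝ) {n : ℕ} {H D : Finset (Fin (n + 1))} (h : takeOne (n + 1) H D) :
    excess p (n + 1 - D.card) - (D \ H).card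
      = if H.card = 0 then excess p n - 1 else excess p n := by
  rw [h.1]
  split_ifs with c
  · rw [Finset.card_eq_zero.mp c, Finset.sdiff_empty, h.1]; simp
  · have : D ⊆ H := h.2 (Finset.nonempty_iff_ne_empty.mpr (by simpa using c))
    simp [Finset.sdiff_eq_empty_iff_subset.mpr this]

/-- For n ≥ 1, A and B disagree only when exactly n of the n + 1 coins show heads, and there the
maximum of `excess p n` and 0 decides. -/
lemma ruleA_goodAt {p : ℝ} {n : ℕ} (h : n = 0 ∨ 0 ≤ excess p n) : GoodAt p ruleA n := by
  intro H
  by_cases c : H.card = n + 1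
  · have hH : H.Nonempty := Finset.card_pos.mp (by omega)
    refine ⟨⟨H, hH, by simp [ruleA, c]⟩, fun D hD => ?_⟩
    simp only [ruleA, c, if_true] at hD
    subst hD
    simp [c, best, excess]
  · constructor
    · simpa only [ruleA, c, if_false] using exists_takeOne n H
    · intro D hD
      simp only [ruleA, c, if_false] at hD
      rw [takeOne_value p hD]
      simp only [best, c, if_false]
      split_ifs with c1 c2
      · rfl
      · rcases h with h | h
        · omega
        · exact (max_eq_left h).symm
      · rfl

lemma ruleB_goodAt {p : ℝ} {n : ℕ} (h : n = 0 ∨ excess p n ≤ 0) : GoodAt p ruleB n := by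
  intro H
  by_cases c : H.Nonempty ∧ (H.card = n + 1 ∨ H.card + 1 = n + 1)
  · refine ⟨⟨H, c.1, by simp only [ruleB, c, if_true, and_self]⟩, fun D hD => ?_⟩
    simp only [ruleB, c, if_true, and_self] at hD
    subst hD
    have := c.1.card_pos
    rcases c.2 with e | e
    · simp [e, best, excess]
    · have e' : D.card = n := by omega
      have : n ≠ 0 := by omega
      have hx : excess p n ≤ 0 := h.resolve_left this
      rw [e', best, if_neg (by omega), if_neg this, if_pos rfl, max_eq_right hx]
      simp [excess, gameSeq]
  · constructor
    · simpa only [ruleB, c, if_false] using exists_takeOne n H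
    · intro D hD
      simp only [ruleB, c, if_false] at hD
      rw [takeOne_value p hD]
      rcases H.eq_empty_or_nonempty with hH | hH
      · simp [hH, best]
      · have c' : ¬ (H.card = n + 1) ∧ ¬ (H.card = n) := by
          constructor <;> intro hh <;> exact c ⟨hH, by omega⟩
        simp [best, c'.1, c'.2]

lemma value_eq {p : ℝ} (h1 : 1 / 2 ≤ p) (h2 : p < 1) {R : Rule} (hR : ∀ n, GoodAt p R n) (n : ℕ) :
    value n p = optimum p n := by
  obtain ⟨τ, hτ⟩ := exists_follows hR n
  apply le_antisymm
  · have : Nonempty (Strategy n) := ⟨τ⟩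
    exact ciSup_le fun σ => payoff_le h1 h2 σ
  · rw [← payoff_eq_of_follows hR τ hτ]
    exact le_ciSup (f := fun σ : Strategy n => σ.payoff p)
      ⟨optimum p n, by rintro _ ⟨σ, rfl⟩; exact payoff_le h1 h2 σ⟩ τ

/-- Decide according to A when the normalized value of one coin less is nonnegative, and according
to B otherwise. -/
noncomputable def bestRule (p : ℝ) : Rule := fun n H D =>
  if 0 ≤ excess p (n - 1) then ruleA n H D else ruleB n H D

lemma goodAt_congr {p : ℝ} {R R' : Rule} {n : ℕ} (h : R (n + 1) = R' (n + 1))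
    (hR : GoodAt p R n) : GoodAt p R' n := by
  intro H
  have := hR H
  rwa [h] at this

lemma bestRule_goodAt (p : ℝ) (n : ℕ) : GoodAt p (bestRule p) n := by
  by_cases h : 0 ≤ excess p n
  · exact goodAt_congr (by funext H D; simp [bestRule, h]) (ruleA_goodAt (Or.inr h))
  · exact goodAt_congr (by funext H D; simp [bestRule, h]) (ruleB_goodAt (Or.inr (le_of_not_ge h)))

lemma optimalDecision_ruleA_or_ruleB {p : ℝ} (h1 : 1 / 2 ≤ p) (h2 : p < 1) (n : ℕ) :
    OptimalDecision p n ruleA ∨ OptimalDecision p n ruleB := by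
  obtain ⟨⟨τ, hτ⟩, hopt⟩ := optimalToFollow_of_goodAt h1 h2 (bestRule_goodAt p) n
  have hf := firstRoundObeys_of_follows hτ
  cases τ with
  | done => exact Or.inl ⟨.done, trivial, hopt _ hτ⟩
  | toss n aside h next =>
    by_cases hx : 0 ≤ excess p n
    · exact Or.inl ⟨_, fun H => by simpa [bestRule, hx] using hf H, hopt _ hτ⟩
    · exact Or.inr ⟨_, fun H => by simpa [bestRule, hx] using hf H, hopt _ hτ⟩

lemma sSeq_succ {p : ℝ} (h1 : 1 / 2 ≤ p) (h2 : p < 1) (n : ℕ) : sSeq (n + 1) p = gameSeq p n := by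
  simp only [sSeq, value_eq h1 h2 (bestRule_goodAt p), optimum, excess]
  ring

lemma not_optimalDecision_ruleA {p : ℝ} (h1 : 1 / 2 ≤ p) (h2 : p < 1) {n : ℕ} (hn : 1 ≤ n)
    (hx : excess p n < 0) : ¬ OptimalDecision p (n + 1) ruleA := by
  rintro ⟨τ, hτ, hopt⟩
  obtain ⟨ρ, hρ⟩ := exists_follows (bestRule_goodAt p) (n + 1)
  have hle := hopt ρ
  rw [payoff_eq_of_follows (bestRule_goodAt p) ρ hρ] at hle
  refine absurd hle (not_le.mpr ?_)
  cases τ with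
  | toss n aside h next =>
    rw [payoff_toss, ← sum_round]
    -- On this outcome, of positive probability, A continues with a negative excess although 0 is
    -- available.
    obtain ⟨H, -, hH⟩ := Finset.exists_subset_card_eq (s := (Finset.univ : Finset (Fin (n + 1))))
      (n := n) (by simp)
    have hle : ∀ H, ((aside H ∩ H).card : ℝ) + (next H).payoff p
        ≤ n + 1 - (1 - p) + (excess p (n + 1 - (aside H).card) - (aside H \ H).card) := by
      intro H
      rw [← round_value]
      linarith [payoff_le h1 h2 (next H)]
    refine Finset.sum_lt_sum (fun H _ => mul_le_mul_of_nonneg_left ?_ (prob_nonneg h1 h2 H))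
      ⟨H, Finset.mem_univ _, mul_lt_mul_of_pos_left ?_ ?_⟩
    · linarith [hle H, le_best h1 h2 n H (aside H) (h H)]
    · refine (hle H).trans_lt ?_
      have hA := hτ H
      simp only [ruleA, hH, Nat.left_eq_add, one_ne_zero, if_false] at hA
      rw [takeOne_value p hA, hH, if_neg (by omega)]
      simp only [best, Nat.left_eq_add, one_ne_zero, if_false, if_true]
      rw [if_neg (by omega), max_eq_right hx.le]
      linarith
    · have : 0 < 1 - p := by linarith
      have : 0 < p := by linarith
      unfold prob; positivity

/-! ### The linear recursion of strategy B -/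

/-- The analogue of `gameSeq` when B is followed throughout. -/
noncomputable def linSeq (p : ℝ) : ℕ → ℝ
  | 0 => 0
  | k + 1 => p ^ (k + 2) * (1 - p) - (1 - p) ^ (k + 2) + (1 - almostAll p (k + 2)) * linSeq p k

/-- The derivative of `linSeq` with respect to `p`. -/
noncomputable def linDeriv (p : ℝ) : ℕ → ℝ
  | 0 => 0
  | k + 1 => (k + 2) * p ^ (k + 1) * (1 - p) - p ^ (k + 2) + (k + 2) * (1 - p) ^ (k + 1)
      - (k + 2) * (k + 1) * p ^ k * (1 - p) * linSeq p k
      + (1 - almostAll p (k + 2)) * linDeriv p k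

lemma hasDerivAt_linSeq (p : ℝ) (k : ℕ) :
    HasDerivAt (fun x => linSeq x k) (linDeriv p k) p := by
  induction k with
  | zero => exact hasDerivAt_const p (0 : ℝ)
  | succ k ih =>
    have hid : HasDerivAt (fun x : ℝ => x) 1 p := hasDerivAt_id p
    have hq : HasDerivAt (fun x : ℝ => 1 - x) (-1) p := by simpa using hid.const_sub 1
    have hA : HasDerivAt (fun x : ℝ => almostAll x (k + 2))
        ((k + 2) * (k + 1) * p ^ k * (1 - p)) p := by
      have h := (hid.fun_pow (k + 2)).fun_add
        (((hid.fun_pow (k + 1)).const_mul ((k + 1 : ℕ) + 1 : ℝ)).fun_mul hq)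
      simp only [almostAll_succ]
      refine h.congr_deriv ?_
      push_cast
      ring
    have h := (((hid.fun_pow (k + 2)).fun_mul hq).fun_sub (hq.fun_pow (k + 2))).fun_add
      ((hA.const_sub 1).fun_mul ih)
    refine h.congr_deriv ?_
    simp only [linDeriv]
    push_cast
    ring

/-- The gap between the two recursions is fed only by the positive part of `gameSeq`, so it stays 0
until the first positive value. -/
lemma gameSeq_succ_sub (p : ℝ) (k : ℕ) :
    gameSeq p (k + 1) - linSeq p (k + 1) = (1 - almostAll p (k + 2)) * (gameSeq p k - linSeq p k)
      + (k + 2) * p ^ (k + 1) * (1 - p) * max (gameSeq p k) 0 := by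
  have : max (gameSeq p k) 0 = gameSeq p k - min (gameSeq p k) 0 := by
    rcases le_total 0 (gameSeq p k) with h | h <;> simp [h]
  rw [this]
  simp only [gameSeq, linSeq, increment, almostAll_succ]
  push_cast
  ring

lemma gameSeq_eq_linSeq {p : ℝ} {k : ℕ} (h : ∀ j < k, gameSeq p j ≤ 0) :
    gameSeq p k = linSeq p k := by
  induction k with
  | zero => rfl
  | succ k ih =>
    have e := gameSeq_succ_sub p k
    rw [ih fun j hj => h j (hj.trans k.lt_succ_self),
      ← ih fun j hj => h j (hj.trans k.lt_succ_self),
      max_eq_right (h k k.lt_succ_self)] at e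
    linarith

lemma gameSeq_nonpos_of_linSeq {p : ℝ} (h : ∀ k, linSeq p k ≤ 0) (k : ℕ) :
    gameSeq p k = linSeq p k ∧ gameSeq p k ≤ 0 := by
  induction k using Nat.strong_induction_on with
  | _ k ih =>
    have := gameSeq_eq_linSeq fun j hj => (ih j hj).2
    exact ⟨this, this ▸ h k⟩

lemma linSeq_le_gameSeq {p : ℝ} (h0 : 0 ≤ p) (h1 : p ≤ 1) (k : ℕ) :
    linSeq p k ≤ gameSeq p k := by
  induction k with
  | zero => exact le_rfl
  | succ k ih =>
    have e := gameSeq_succ_sub p k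
    have h2 : 0 ≤ 1 - almostAll p (k + 2) := sub_nonneg.mpr (almostAll_le_one h0 _)
    have h3 : 0 ≤ gameSeq p k - linSeq p k := sub_nonneg.mpr ih
    have h4 : 0 ≤ 1 - p := by linarith
    have : 0 ≤ gameSeq p (k + 1) - linSeq p (k + 1) := by rw [e]; positivity
    linarith

/-- All terms of the recursion are nonnegative; the bound 2/3 is what (k + 2)(1 - p) ≥ p requires at
k = 0. -/
lemma linDeriv_nonneg {p : ℝ} (h0 : 0 ≤ p) (h1 : p ≤ 2 / 3) {k : ℕ}
    (h : ∀ j < k, linSeq p j ≤ 0) : 0 ≤ linDeriv p k := by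
  induction k with
  | zero => exact le_rfl
  | succ k ih =>
    have hq : 0 ≤ 1 - p := by linarith
    have h2 : 0 ≤ 1 - almostAll p (k + 2) := sub_nonneg.mpr (almostAll_le_one h0 _)
    have h3 := ih fun j hj => h j (hj.trans k.lt_succ_self)
    have h4 : 0 ≤ -linSeq p k := neg_nonneg.mpr (h k k.lt_succ_self)
    have h5 : 0 ≤ (k + 2) * (1 - p) - p := by
      have : 0 ≤ (k : ℝ) * (1 - p) := by positivity
      linarith
    have : linDeriv p (k + 1) = p ^ (k + 1) * ((k + 2) * (1 - p) - p) + (k + 2) * (1 - p) ^ (k + 1)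
      + (k + 2) * (k + 1) * p ^ k * (1 - p) * (-linSeq p k)
      + (1 - almostAll p (k + 2)) * linDeriv p k := by
      simp only [linDeriv]; ring
    rw [this]
    positivity

/-- The factor 1 - `almostAll` takes away at most a fraction `almostAll` of the lower bound 1/5, and
the inhomogeneous terms pay for it. -/
lemma linDeriv_ge {p : ℝ} (h0 : 0 ≤ p) (h1 : p ≤ 14 / 25) {k : ℕ}
    (h : ∀ j ≤ k, linSeq p j ≤ 0) : 1 / 5 ≤ linDeriv p (k + 1) := by
  induction k with
  | zero => simp [linDeriv, linSeq]; nlinarith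
  | succ k ih =>
    have hq : 0 ≤ 1 - p := by linarith
    have h2 : 0 ≤ 1 - almostAll p (k + 1 + 2) := sub_nonneg.mpr (almostAll_le_one h0 _)
    have h3 := ih fun j hj => h j (hj.trans k.le_succ)
    have h4 : 0 ≤ -linSeq p (k + 1) := neg_nonneg.mpr (h (k + 1) le_rfl)
    have h5 : 0 ≤ (k + 3) * (1 - p) - p - 1 / 5 * (p + (k + 3) * (1 - p)) := by
      have : 0 ≤ (k : ℝ) * (1 - p) := by positivity
      linarith
    have : linDeriv p (k + 1 + 1) = 1 / 5
      + p ^ (k + 2) * ((k + 3) * (1 - p) - p - 1 / 5 * (p + (k + 3) * (1 - p)))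
      + (k + 3) * (1 - p) ^ (k + 2)
      + (k + 3) * (k + 2) * p ^ (k + 1) * (1 - p) * (-linSeq p (k + 1))
      + (1 - almostAll p (k + 1 + 2)) * (linDeriv p (k + 1) - 1 / 5) := by
      rw [linDeriv, almostAll_succ]; push_cast; ring
    rw [this]
    have h6 : 0 ≤ linDeriv p (k + 1) - 1 / 5 := sub_nonneg.mpr h3
    have : 0 ≤ p ^ (k + 2) * ((k + 3) * (1 - p) - p - 1 / 5 * (p + (k + 3) * (1 - p)))
      + (k + 3) * (1 - p) ^ (k + 2)
      + (k + 3) * (k + 2) * p ^ (k + 1) * (1 - p) * (-linSeq p (k + 1))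
      + (1 - almostAll p (k + 1 + 2)) * (linDeriv p (k + 1) - 1 / 5) := by positivity
    linarith

lemma continuous_linSeq (k : ℕ) : Continuous fun p => linSeq p k :=
  continuous_iff_continuousAt.mpr fun p => (hasDerivAt_linSeq p k).continuousAt

lemma continuous_gameSeq (k : ℕ) : Continuous fun p => gameSeq p k := by
  induction k with
  | zero => exact continuous_const
  | succ k ih => simp only [gameSeq, increment]; fun_prop

/-- If the earlier terms are nonpositive on [0, p'], the next one is nondecreasing there, so its
sign at p' decides. -/
lemma linSeq_nonpos_of_le {p p' : ℝ} (h0 : 0 ≤ p) (hpp : p ≤ p') (h1 : p' ≤ 2 / 3)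
    (h : ∀ k, linSeq p' k ≤ 0) (k : ℕ) : linSeq p k ≤ 0 := by
  suffices ∀ k, ∀ x ∈ Set.Icc 0 p', linSeq x k ≤ 0 from this k p ⟨h0, hpp⟩
  intro k
  induction k using Nat.strong_induction_on with
  | _ k ih =>
    have hmono : MonotoneOn (fun x => linSeq x k) (Set.Icc 0 p') := by
      refine monotoneOn_of_deriv_nonneg (convex_Icc _ _) (continuous_linSeq k).continuousOn
        (fun x _ => (hasDerivAt_linSeq x k).differentiableAt.differentiableWithinAt) fun x hx => ?_
      rw [interior_Icc] at hx
      rw [(hasDerivAt_linSeq x k).deriv]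
      exact linDeriv_nonneg hx.1.le (hx.2.le.trans h1) fun j hj => ih j hj x ⟨hx.1.le, hx.2.le⟩
    intro x hx
    exact (hmono hx ⟨hx.1.trans hx.2, le_rfl⟩ hx.2).trans (h k)

/-! ### Locating the threshold by exact arithmetic -/

/-- `linSeq` at `p = P / D`, `1 - p = Q / D`, with denominators cleared. -/
def intSeq (P Q D : ℕ) : ℕ → ℤ × ℕ
  | 0 => (0, 0)
  | k + 1 =>
    let s := intSeq P Q D k
    ((((P ^ (k + 2) * Q : ℕ) : ℤ) - ((Q ^ (k + 2) * D : ℕ) : ℤ)) * ((D ^ s.2 : ℕ) : ℤ)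
      + ((((D ^ (k + 2) : ℕ) : ℤ) - ((P ^ (k + 2) + (k + 2) * P ^ (k + 1) * Q : ℕ) : ℤ)) *
        (D : ℤ)) * s.1, s.2 + (k + 3))

lemma intSeq_eq {P Q D : ℕ} (hD : 0 < D) (hPQ : P + Q = D) (k : ℕ) :
    ((intSeq P Q D k).1 : ℝ) = D ^ (intSeq P Q D k).2 * linSeq (P / D) k := by
  have hD' : (D : ℝ) ≠ 0 := by positivity
  induction k with
  | zero => simp [intSeq, linSeq]
  | succ k ih =>
    have hq : 1 - (P / D : ℝ) = Q / D := by
      rw [← hPQ] at hD' ⊢; push_cast at hD' ⊢; field_simp; ring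
    simp only [intSeq, linSeq, almostAll_succ, hq]
    push_cast
    rw [ih]
    generalize linSeq (P / D : ℝ) k = x
    simp only [div_pow]
    field_simp
    ring

lemma linSeq_le_of_intSeq {P Q D : ℕ} (hD : 0 < D) (hPQ : P + Q = D) {k m : ℕ}
    (h : (intSeq P Q D k).1 * (D ^ m : ℕ) ≤ -((P ^ m * D ^ (intSeq P Q D k).2 : ℕ) : ℤ)) :
    linSeq (P / D) k ≤ -(P / D : ℝ) ^ m := by
  have h1 : ((intSeq P Q D k).1 : ℝ) * ((D ^ m : ℕ) : ℝ)
      ≤ -((P ^ m * D ^ (intSeq P Q D k).2 : ℕ) : ℝ) := by exact_mod_cast h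
  rw [intSeq_eq hD hPQ] at h1
  push_cast at h1
  have hw : (0 : ℝ) < D ^ (intSeq P Q D k).2 := by positivity
  rw [div_pow, ← neg_div, le_div_iff₀ (by positivity)]
  refine le_of_mul_le_mul_left ?_ hw
  linarith

/-- A self-sustaining bound that reduces infinitely many signs to finitely many: 1 - `almostAll` ≥
4/5 from 18 coins on, while p(2 - p) ≤ 4/5 for p ≤ 11/20. -/
lemma linSeq_le_neg_pow {p : ℝ} (h0 : 0 ≤ p) (h1 : p ≤ 11 / 20) {j : ℕ} (hj : 16 ≤ j)
    (h : linSeq p j ≤ -p ^ (j + 1)) (k : ℕ) : linSeq p (j + k) ≤ -p ^ (j + k + 1) := by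
  have hA : ∀ k, almostAll p (18 + k) ≤ 1 / 5 := by
    intro k
    induction k with
    | zero =>
      simp only [almostAll]
      have a : p ^ 17 ≤ (11 / 20) ^ 17 := by gcongr
      have b : p ^ 18 ≤ (11 / 20) ^ 18 := by gcongr
      have c : p ^ 17 * (1 - p) ≤ (11 / 20) ^ 17 * 1 := by gcongr <;> linarith
      norm_num at *
      linarith
    | succ k ih =>
      rw [show 18 + (k + 1) = 18 + k + 1 by ring, almostAll_step]
      have : 0 ≤ ((18 + k : ℕ) : ℝ) * p ^ (18 + k - 1) * (1 - p) ^ 2 := by positivity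
      linarith
  induction k with
  | zero => exact h
  | succ k ih =>
    have hq : 0 ≤ 1 - p := by linarith
    obtain ⟨i, hi⟩ := Nat.exists_eq_add_of_le (show 18 ≤ j + k + 2 by omega)
    have hA' := hA i
    rw [← hi] at hA'
    have e : linSeq p (j + (k + 1)) = p ^ (j + k + 2) * (1 - p) - (1 - p) ^ (j + k + 2)
      + (1 - almostAll p (j + k + 2)) * linSeq p (j + k) := rfl
    rw [e]
    have h2 : (1 - almostAll p (j + k + 2)) * linSeq p (j + k)
        ≤ (1 - almostAll p (j + k + 2)) * (-p ^ (j + k + 1)) := by gcongr; linarith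
    have h3 : 4 / 5 * p ^ (j + k + 1) ≤ (1 - almostAll p (j + k + 2)) * p ^ (j + k + 1) := by
      gcongr; linarith
    have h4 : 0 ≤ (1 - p) ^ (j + k + 2) := by positivity
    have h5 : p ^ (j + k + 2) * (1 - p) + p ^ (j + (k + 1) + 1)
        = p ^ (j + k + 1) * (p * (2 - p)) := by ring
    have h6 : p ^ (j + k + 1) * (p * (2 - p)) ≤ p ^ (j + k + 1) * (4 / 5) := by
      gcongr; nlinarith
    linarith

lemma linSeq_nonpos_lower (k : ℕ) : linSeq (549502177764191 / 10 ^ 15) k ≤ 0 := by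
  have hint := fun k => intSeq_eq (P := 549502177764191) (Q := 450497822235809) (D := 10 ^ 15)
    (by norm_num) (by norm_num) k
  have hpD : ((549502177764191 : ℕ) : ℝ) / ((10 ^ 15 : ℕ) : ℝ) = 549502177764191 / 10 ^ 15 := by
    push_cast; norm_num
  rw [hpD] at hint
  have hsmall : ∀ k < 56, (intSeq 549502177764191 450497822235809 (10 ^ 15) k).1 ≤ 0 := by
    decide +kernel
  -- At index 55 the bound of `linSeq_le_neg_pow` holds and takes over.
  have hend : (intSeq 549502177764191 450497822235809 (10 ^ 15) 55).1 * ((10 ^ 15) ^ 56 : ℕ)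
      ≤ -((549502177764191 ^ 56 * (10 ^ 15) ^
        (intSeq 549502177764191 450497822235809 (10 ^ 15) 55).2 : ℕ) : ℤ) := by decide +kernel
  rcases Nat.lt_or_ge k 55 with hk | hk
  · have h1 : ((intSeq 549502177764191 450497822235809 (10 ^ 15) k).1 : ℝ) ≤ 0 := by
      exact_mod_cast hsmall k (by omega)
    rw [hint] at h1
    exact nonpos_of_mul_nonpos_right h1 (by positivity)
  · obtain ⟨i, rfl⟩ := Nat.exists_eq_add_of_le hk
    refine (linSeq_le_neg_pow (by norm_num) (by norm_num) (by norm_num) ?_ i).trans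
      (neg_nonpos.mpr (by positivity))
    have h1 := linSeq_le_of_intSeq (by norm_num) (by norm_num) hend
    rwa [hpD] at h1

lemma linSeq_pos_upper : 0 < linSeq (549502177764209 / 10 ^ 15) 59 := by
  have hint := intSeq_eq (P := 549502177764209) (Q := 450497822235791) (D := 10 ^ 15)
    (by norm_num) (by norm_num) 59
  have hpD : ((549502177764209 : ℕ) : ℝ) / ((10 ^ 15 : ℕ) : ℝ) = 549502177764209 / 10 ^ 15 := by
    push_cast; norm_num
  rw [hpD] at hint
  have hpos : 0 < (intSeq 549502177764209 450497822235791 (10 ^ 15) 59).1 := by decide +kernel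
  have : (0 : ℝ) < ((intSeq 549502177764209 450497822235791 (10 ^ 15) 59).1 : ℝ) := by
    exact_mod_cast hpos
  rw [hint] at this
  exact pos_of_mul_pos_right this (by positivity)

/-! ### The threshold -/

/-- The set of success probabilities for which following B throughout is best. -/
def lowSet : Set ℝ := {p | 1 / 2 ≤ p ∧ p ≤ 2 / 3 ∧ ∀ k, linSeq p k ≤ 0}

/-- The largest success probability for which following B throughout is best. -/
noncomputable def threshold : ℝ := sSup lowSet

lemma bddAbove_lowSet : BddAbove lowSet := ⟨2 / 3, fun _ h => h.2.1⟩

lemma lower_mem_lowSet : (549502177764191 / 10 ^ 15 : ℝ) ∈ lowSet :=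
  ⟨by norm_num, by norm_num, linSeq_nonpos_lower⟩

lemma threshold_mem : threshold ∈ lowSet := by
  refine IsClosed.csSup_mem ?_ ⟨_, lower_mem_lowSet⟩ bddAbove_lowSet
  simp only [lowSet, Set.ofPred_and, Set.ofPred_forall]
  exact isClosed_Ici.inter (isClosed_Iic.inter
    (isClosed_iInter fun k => isClosed_le (continuous_linSeq k) continuous_const))

lemma lower_le_threshold : 549502177764191 / 10 ^ 15 ≤ threshold :=
  le_csSup bddAbove_lowSet lower_mem_lowSet

lemma threshold_le_upper : threshold ≤ 549502177764209 / 10 ^ 15 := by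
  by_contra! h
  have := linSeq_nonpos_of_le (by norm_num) h.le threshold_mem.2.1 threshold_mem.2.2 59
  exact absurd linSeq_pos_upper this.not_gt

lemma linSeq_threshold_nonpos (k : ℕ) : linSeq threshold k ≤ 0 := threshold_mem.2.2 k

lemma gameSeq_nonpos_of_le_threshold {p : ℝ} (h0 : 0 ≤ p) (h : p ≤ threshold) (k : ℕ) :
    gameSeq p k = linSeq p k ∧ gameSeq p k ≤ 0 :=
  gameSeq_nonpos_of_linSeq
    (linSeq_nonpos_of_le h0 h threshold_mem.2.1 threshold_mem.2.2) k

lemma exists_gameSeq_pos {p : ℝ} (h : threshold < p) (h1 : p ≤ 2 / 3) :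
    ∃ k, 0 < gameSeq p k := by
  by_contra! hc
  have hp : 1 / 2 ≤ p := threshold_mem.1.trans h.le
  refine absurd (le_csSup bddAbove_lowSet (a := p) ⟨hp, h1, fun k => ?_⟩) (not_le.mpr h)
  rw [← gameSeq_eq_linSeq fun j _ => hc j]
  exact hc k

/-! ### Uniform convergence of the derivatives -/

/-- The inhomogeneous term is at most `almostAll` in absolute value, the complement of the factor of
the previous term. -/
lemma abs_linSeq_le_one {p : ℝ} (h0 : 1 / 2 ≤ p) (h1 : p ≤ 1) (k : ℕ) : |linSeq p k| ≤ 1 := by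
  induction k with
  | zero => simp [linSeq]
  | succ k ih =>
    have hp : 0 ≤ p := by linarith
    have hq : 0 ≤ 1 - p := by linarith
    have h2 : 0 ≤ 1 - almostAll p (k + 2) := sub_nonneg.mpr (almostAll_le_one hp _)
    have h3 : |p ^ (k + 2) * (1 - p) - (1 - p) ^ (k + 2)| ≤ almostAll p (k + 2) := by
      have a : (1 - p) ^ (k + 2) ≤ p ^ (k + 2) := by gcongr; linarith
      have b : p ^ (k + 2) * (1 - p) ≤ p ^ (k + 2) * 1 := by gcongr; linarith
      have c : 0 ≤ (1 - p) ^ (k + 2) := by positivity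
      have d : 0 ≤ p ^ (k + 2) * (1 - p) := by positivity
      have e : p ^ (k + 2) ≤ almostAll p (k + 2) := by
        rw [almostAll]; exact le_add_of_nonneg_right (by positivity)
      rw [abs_le]
      constructor <;> linarith
    simp only [linSeq]
    refine (abs_add_le _ _).trans ?_
    rw [abs_mul, abs_of_nonneg h2]
    have := mul_le_mul_of_nonneg_left ih h2
    linarith

/-- A summable bound for the increments of `linDeriv`. -/
noncomputable def derivBound (k : ℕ) : ℝ := 4 * (k + 2) ^ 2 * (14 / 25) ^ k

lemma derivBound_nonneg (k : ℕ) : 0 ≤ derivBound k := by unfold derivBound; positivity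

lemma summable_derivBound : Summable derivBound := by
  have hr : ‖(14 / 25 : ℝ)‖ < 1 := by norm_num
  have h := ((summable_pow_mul_geometric_of_norm_lt_one 2 hr).mul_left 4).add
    (((summable_pow_mul_geometric_of_norm_lt_one 1 hr).mul_left 16).add
    ((summable_pow_mul_geometric_of_norm_lt_one 0 hr).mul_left 16))
  refine h.congr fun k => ?_
  simp only [derivBound]
  ring

lemma almostAll_le_derivBound {p : ℝ} (h0 : 1 / 2 ≤ p) (h1 : p ≤ 14 / 25) (k : ℕ) :
    almostAll p (k + 2) ≤ derivBound k := by
  have hp : 0 ≤ p := by linarith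
  have hq : 0 ≤ 1 - p := by linarith
  have a : p ^ k ≤ (14 / 25) ^ k := by gcongr
  have e : almostAll p (k + 2) = p ^ k * (p ^ 2 + (k + 2) * (p * (1 - p))) := by
    rw [almostAll_succ]; push_cast; ring
  have b : p ^ 2 + (k + 2) * (p * (1 - p)) ≤ 4 * (k + 2) ^ 2 := by
    have : (k + 2) * (p * (1 - p)) ≤ ((k : ℝ) + 2) * 1 := by gcongr; nlinarith
    nlinarith [(Nat.cast_nonneg k : (0 : ℝ) ≤ k)]
  rw [e, derivBound, mul_comm]
  gcongr

lemma abs_linDeriv_succ_sub_le {p : ℝ} (h0 : 1 / 2 ≤ p) (h1 : p ≤ 14 / 25) (k : ℕ) :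
    |linDeriv p (k + 1) - (1 - almostAll p (k + 2)) * linDeriv p k| ≤ derivBound k := by
  have hp : 0 ≤ p := by linarith
  have hq : 0 ≤ 1 - p := by linarith
  have hk : (0 : ℝ) ≤ k := Nat.cast_nonneg k
  have a : p ^ k ≤ (14 / 25) ^ k := by gcongr
  have b : (1 - p) ^ k ≤ (14 / 25) ^ k := by gcongr; linarith
  have hl := abs_le.mp (abs_linSeq_le_one h0 (by linarith) k)
  generalize hr : ((14 / 25 : ℝ)) ^ k = r at *
  have hr0 : 0 ≤ r := by rw [← hr]; positivity
  have e : linDeriv p (k + 1) - (1 - almostAll p (k + 2)) * linDeriv p k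
      = p ^ k * ((k + 2) * (p * (1 - p)) - p ^ 2 - (k + 2) * (k + 1) * ((1 - p) * linSeq p k))
        + (1 - p) ^ k * ((k + 2) * (1 - p)) := by
    simp only [linDeriv]; ring
  have hx : |(1 - p) * linSeq p k| ≤ 1 := by
    rw [abs_mul, abs_of_nonneg hq]
    exact mul_le_one₀ (by linarith) (abs_nonneg _) (abs_le.mpr hl)
  have h2 : |((k : ℝ) + 2) * (p * (1 - p)) - p ^ 2 - (k + 2) * (k + 1) * ((1 - p) * linSeq p k)|
      ≤ 3 * ((k : ℝ) + 2) ^ 2 := by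
    obtain ⟨x1, x2⟩ := abs_le.mp hx
    generalize (1 - p) * linSeq p k = y at *
    have c1 : 0 ≤ p * (1 - p) := by positivity
    have c2 : p * (1 - p) ≤ 1 := by nlinarith
    have c3 : p ^ 2 ≤ 1 := by nlinarith
    have d1 : (k + 2) * (p * (1 - p)) ≤ ((k : ℝ) + 2) * 1 := by gcongr
    have d2 : 0 ≤ ((k : ℝ) + 2) * (p * (1 - p)) := by positivity
    have d3 : ((k : ℝ) + 2) * (k + 1) * y ≤ (k + 2) * (k + 1) * 1 := by gcongr
    have d4 : ((k : ℝ) + 2) * (k + 1) * (-1) ≤ (k + 2) * (k + 1) * y := by gcongr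
    rw [abs_le]
    constructor <;> nlinarith
  have h3 : |((k : ℝ) + 2) * (1 - p)| ≤ ((k : ℝ) + 2) ^ 2 := by
    rw [abs_of_nonneg (by positivity)]
    nlinarith
  rw [e, derivBound, hr]
  refine (abs_add_le _ _).trans ?_
  rw [abs_mul, abs_mul, abs_of_nonneg (pow_nonneg hp k), abs_of_nonneg (pow_nonneg hq k)]
  have := mul_le_mul a h2 (abs_nonneg _) hr0
  have := mul_le_mul b h3 (abs_nonneg _) hr0
  linarith

lemma abs_linDeriv_le {p : ℝ} (h0 : 1 / 2 ≤ p) (h1 : p ≤ 14 / 25) (k : ℕ) :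
    |linDeriv p k| ≤ ∑' j, derivBound j := by
  refine le_trans ?_ (summable_derivBound.sum_le_tsum (Finset.range k)
    fun j _ => derivBound_nonneg j)
  induction k with
  | zero => simp [linDeriv]
  | succ k ih =>
    have hp : 0 ≤ p := by linarith
    have h2 := almostAll_le_one hp (k + 2)
    have h3 := almostAll_nonneg hp (by linarith) (k + 2)
    have h4 := abs_linDeriv_succ_sub_le h0 h1 k
    have h5 : |(1 - almostAll p (k + 2)) * linDeriv p k| ≤ |linDeriv p k| := by
      rw [abs_mul, abs_of_nonneg (by linarith)]
      exact mul_le_of_le_one_left (abs_nonneg _) (by linarith)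
    have h6 := abs_sub_abs_le_abs_sub (linDeriv p (k + 1))
      ((1 - almostAll p (k + 2)) * linDeriv p k)
    rw [Finset.sum_range_succ]
    linarith

/-- The derivative of the limit of `linSeq`. -/
noncomputable def limitDeriv (p : ℝ) : ℝ := ∑' k, (linDeriv p (k + 1) - linDeriv p k)

/-- Weierstrass M-test for the telescoping series of increments. -/
lemma tendstoUniformlyOn_linDeriv :
    TendstoUniformlyOn (fun k p => linDeriv p k) limitDeriv atTop (Set.Icc (1 / 2) (14 / 25)) := by
  have h := tendstoUniformlyOn_tsum_nat
    (f := fun k p => linDeriv p (k + 1) - linDeriv p k) (s := Set.Icc (1 / 2) (14 / 25))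
    (summable_derivBound.mul_right (1 + ∑' j, derivBound j)) fun k p hp => by
      have hp0 : 0 ≤ p := by linarith [hp.1]
      have h2 := almostAll_le_derivBound hp.1 hp.2 k
      have h3 := almostAll_nonneg hp0 (by linarith [hp.2]) (k + 2)
      have h4 := abs_linDeriv_succ_sub_le hp.1 hp.2 k
      have h5 := abs_linDeriv_le hp.1 hp.2 k
      have e : linDeriv p (k + 1) - linDeriv p k
          = (linDeriv p (k + 1) - (1 - almostAll p (k + 2)) * linDeriv p k)
            - almostAll p (k + 2) * linDeriv p k := by ring
      rw [Real.norm_eq_abs, e]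
      refine (abs_sub _ _).trans ?_
      rw [abs_mul, abs_of_nonneg h3]
      have := mul_le_mul h2 h5 (abs_nonneg _) (derivBound_nonneg k)
      linarith
  refine h.congr (Eventually.of_forall fun k p _ => ?_)
  exact (Finset.sum_range_sub (linDeriv p) k).trans (sub_zero _)

lemma continuous_linDeriv (k : ℕ) : Continuous fun p => linDeriv p k := by
  induction k with
  | zero => exact continuous_const
  | succ k ih =>
    have := continuous_linSeq k
    simp only [linDeriv, almostAll]
    fun_prop

lemma threshold_mem_Ioo : threshold ∈ Set.Ioo (549 / 1000 : ℝ) (11 / 20) :=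
  ⟨by linarith [lower_le_threshold], by linarith [threshold_le_upper]⟩

lemma limitDeriv_threshold_ge : 1 / 5 ≤ limitDeriv threshold := by
  have ht := threshold_mem_Ioo
  have h := tendstoUniformlyOn_linDeriv.tendsto_at
    (show threshold ∈ Set.Icc (1 / 2) (14 / 25) from ⟨by linarith [ht.1], by linarith [ht.2]⟩)
  refine ge_of_tendsto h (eventually_atTop.mpr ⟨1, fun k hk => ?_⟩)
  obtain ⟨j, rfl⟩ := Nat.exists_eq_add_of_le' hk
  exact linDeriv_ge (by linarith [ht.1]) (by linarith [ht.2]) fun j _ => linSeq_threshold_nonpos j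

/-- Mean value inequality. One δ serves all large k, as is needed for the index `crossing p`, which
varies with p. -/
lemma exists_abs_linSeq_sub_le {ε : ℝ} (hε : 0 < ε) :
    ∃ δ > 0, ∃ K : ℕ, ∀ k ≥ K, ∀ p, |p - threshold| < δ →
      |linSeq p k - linSeq threshold k - limitDeriv threshold * (p - threshold)|
        ≤ ε * |p - threshold| := by
  have ht := threshold_mem_Ioo
  have hnhds : Set.Icc (1 / 2 : ℝ) (14 / 25) ∈ 𝓝 threshold :=
    Icc_mem_nhds (by linarith [ht.1]) (by linarith [ht.2])
  have hcont : ContinuousAt limitDeriv threshold :=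
    (tendstoUniformlyOn_linDeriv.continuousOn
      (Eventually.of_forall fun k => (continuous_linDeriv k).continuousOn).frequently).continuousAt
      hnhds
  have hunif := Metric.tendstoUniformlyOn_iff.mp tendstoUniformlyOn_linDeriv (ε / 2) (half_pos hε)
  obtain ⟨K, hK⟩ := eventually_atTop.mp hunif
  obtain ⟨δ, hδ, hball⟩ := Metric.mem_nhds_iff.mp
    (inter_mem hnhds (hcont (Metric.ball_mem_nhds _ (half_pos hε))))
  refine ⟨δ, hδ, K, fun k hk p hp => ?_⟩
  have hd : ∀ x ∈ Metric.ball threshold δ,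
      HasDerivWithinAt (fun x => linSeq x k - limitDeriv threshold * x)
        (linDeriv x k - limitDeriv threshold) (Metric.ball threshold δ) x := fun x _ => by
    have := (hasDerivAt_linSeq x k).fun_sub ((hasDerivAt_id x).const_mul (limitDeriv threshold))
    simpa using this.hasDerivWithinAt
  have hb : ∀ x ∈ Metric.ball threshold δ, ‖linDeriv x k - limitDeriv threshold‖ ≤ ε := by
    intro x hx
    have h1 := hK k hk x (hball hx).1
    have h2 : dist (limitDeriv x) (limitDeriv threshold) < ε / 2 := (hball hx).2
    rw [dist_comm] at h1
    rw [← dist_eq_norm]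
    linarith [dist_triangle (linDeriv x k) (limitDeriv x) (limitDeriv threshold)]
  have := (convex_ball threshold δ).norm_image_sub_le_of_norm_hasDerivWithin_le hd hb
    (Metric.mem_ball_self hδ) (show p ∈ Metric.ball threshold δ by simpa [Real.dist_eq] using hp)
  rw [Real.norm_eq_abs, Real.norm_eq_abs] at this
  convert this using 2
  ring

/-! ### The limit and the index of the sign change -/

/-- The limit of the normalized values. -/
noncomputable def limitValue (p : ℝ) : ℝ := ⨆ k, gameSeq p (k + 1)

lemma tendsto_gameSeq {p : ℝ} (h1 : 1 / 2 ≤ p) (h2 : p < 1) :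
    Tendsto (gameSeq p) atTop (𝓝 (limitValue p)) :=
  (tendsto_add_atTop_iff_nat 1).mp (tendsto_atTop_ciSup (gameSeq_mono h1 h2)
    ⟨1 - p, by rintro _ ⟨k, rfl⟩; exact gameSeq_le h1 h2 _⟩)

lemma gameSeq_le_limitValue {p : ℝ} (h1 : 1 / 2 ≤ p) (h2 : p < 1) {k : ℕ} (hk : 1 ≤ k) :
    gameSeq p k ≤ limitValue p := by
  obtain ⟨j, rfl⟩ := Nat.exists_eq_add_of_le' hk
  exact (gameSeq_mono h1 h2).ge_of_tendsto
    ((tendsto_add_atTop_iff_nat 1).mpr (tendsto_gameSeq h1 h2)) j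

/-- One less than the number of coins up to which B is best. -/
noncomputable def crossing (p : ℝ) : ℕ := sInf {k | 1 ≤ k ∧ 0 ≤ gameSeq p k}

lemma gameSeq_neg_of_lt_crossing {p : ℝ} {k : ℕ} (h : 1 ≤ k) (hk : k < crossing p) :
    gameSeq p k < 0 := by
  by_contra! hc
  exact Nat.notMem_of_lt_sInf hk ⟨h, hc⟩

lemma gameSeq_eq_linSeq_of_le_crossing {p : ℝ} {k : ℕ} (hk : k ≤ crossing p) :
    gameSeq p k = linSeq p k := by
  refine gameSeq_eq_linSeq fun j hj => ?_
  rcases Nat.eq_zero_or_pos j with rfl | h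
  · exact le_rfl
  · exact (gameSeq_neg_of_lt_crossing h (by omega)).le

lemma crossing_spec {p : ℝ} (h : threshold < p) (h1 : p ≤ 2 / 3) :
    1 ≤ crossing p ∧ 0 ≤ gameSeq p (crossing p) := by
  refine Nat.sInf_mem (s := {k | 1 ≤ k ∧ 0 ≤ gameSeq p k}) ?_
  obtain ⟨k, hk⟩ := exists_gameSeq_pos h h1
  refine ⟨k, ?_, hk.le⟩
  rcases Nat.eq_zero_or_pos k with rfl | h
  · exact absurd hk (lt_irrefl 0)
  · exact h

lemma gameSeq_nonneg_of_crossing_le {p : ℝ} (h : threshold < p) (h1 : p ≤ 2 / 3) {k : ℕ}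
    (hk : crossing p ≤ k) : 0 ≤ gameSeq p k := by
  obtain ⟨a, b⟩ := crossing_spec h h1
  obtain ⟨i, hi⟩ := Nat.exists_eq_add_of_le' a
  obtain ⟨j, rfl⟩ := Nat.exists_eq_add_of_le hk
  rw [hi] at b ⊢
  have := gameSeq_mono (threshold_mem.1.trans h.le) (by linarith) (Nat.le_add_right i j)
  simp only at this
  rw [show i + 1 + j = i + j + 1 by ring]
  exact b.trans this

/-- A value 0 would be followed by a positive one. The argument is made three indices later, where
p⁶ > (1 - p)⁵ makes the next increment positive; monotonicity carries it back. -/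
lemma gameSeq_threshold_neg {k : ℕ} (hk : 1 ≤ k) : gameSeq threshold k < 0 := by
  obtain ⟨i, rfl⟩ := Nat.exists_eq_add_of_le' hk
  have ht := threshold_mem_Ioo
  have hp : 0 < threshold := by linarith [ht.1]
  have hq : 0 < 1 - threshold := by linarith [ht.2]
  have hnp := fun k => gameSeq_nonpos_of_le_threshold hp.le le_rfl k
  refine (gameSeq_mono threshold_mem.1 (by linarith) (Nat.le_add_right i 3)).trans_lt
    (lt_of_le_of_ne (hnp _).2 fun h0 => ?_)
  have h1 := (hnp (i + 3 + 1 + 1)).2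
  simp only at h0
  rw [gameSeq, h0] at h1
  simp only [increment, min_self, mul_zero, sub_zero, zero_add] at h1
  have a : (1 - threshold) ^ i ≤ threshold ^ i := by gcongr; linarith [ht.1]
  have b : (1 - threshold) ^ 5 ≤ (451 / 1000) ^ 5 := by gcongr; linarith [ht.1]
  have c : (549 / 1000) ^ 6 ≤ threshold ^ 6 := by gcongr; exact ht.1.le
  have d : (1 - threshold) ^ 5 < threshold ^ 6 := by norm_num at b c ⊢; linarith
  have e : (1 - threshold) ^ i * (1 - threshold) ^ 5 < threshold ^ i * threshold ^ 6 := by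
    have : 0 < threshold ^ i := by positivity
    have : (1 - threshold) ^ i * (1 - threshold) ^ 5 ≤ threshold ^ i * (1 - threshold) ^ 5 := by
      gcongr
    nlinarith
  have : 0 < (1 - threshold) * (threshold ^ i * threshold ^ 6
    - (1 - threshold) ^ i * (1 - threshold) ^ 5) := mul_pos hq (by linarith)
  refine absurd h1 (not_le.mpr (this.trans_eq ?_))
  ring

lemma eventually_mem_Ioo : ∀ᶠ p in 𝓝[>] threshold, p ∈ Set.Ioo threshold (14 / 25) :=
  Ioo_mem_nhdsGT (by linarith [threshold_mem_Ioo.2])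

/-- Any fixed term is negative at the threshold, hence by continuity also nearby. -/
lemma tendsto_crossing : Tendsto crossing (𝓝[>] threshold) atTop := by
  refine tendsto_atTop.mpr fun M => ?_
  have h : ∀ᶠ p in 𝓝[>] threshold, gameSeq p (M + 1) < 0 :=
    nhdsWithin_le_nhds ((continuous_gameSeq (M + 1)).continuousAt.eventually_lt
      continuousAt_const (gameSeq_threshold_neg (Nat.le_add_left 1 M)))
  filter_upwards [h, eventually_mem_Ioo] with p hp hI
  by_contra! hc
  exact absurd hp (not_lt.mpr (gameSeq_nonneg_of_crossing_le hI.1 (by linarith [hI.2]) (by omega)))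

/-- For p just above the threshold `linSeq p (crossing p)` is ≥ 0, and the uniform expansion makes
the same term at the threshold at least -O(p - `threshold`). -/
lemma limitValue_threshold : limitValue threshold = 0 := by
  have ht := threshold_mem_Ioo
  have hp : 0 ≤ threshold := by linarith [ht.1]
  have hlim := tendsto_gameSeq threshold_mem.1 (by linarith [ht.2])
  refine le_antisymm (le_of_tendsto' hlim fun k =>
    (gameSeq_nonpos_of_le_threshold hp le_rfl k).2) ?_
  obtain ⟨δ, hδ, K, hK⟩ := exists_abs_linSeq_sub_le one_pos
  have hev : ∀ᶠ p in 𝓝[>] threshold,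
      -((limitDeriv threshold + 1) * (p - threshold)) ≤ limitValue threshold := by
    filter_upwards [tendsto_crossing.eventually_ge_atTop K, eventually_mem_Ioo,
      Ioo_mem_nhdsGT (show threshold < threshold + δ by linarith)] with p h1 h2 h3
    have hpos : 0 < p - threshold := by linarith [h2.1]
    have h4 := hK _ h1 p (by rw [abs_of_pos hpos]; linarith [h3.2])
    rw [abs_of_pos hpos] at h4
    have h5 := crossing_spec h2.1 (by linarith [h2.2])
    rw [gameSeq_eq_linSeq_of_le_crossing le_rfl] at h5
    have h6 := gameSeq_le_limitValue threshold_mem.1 (by linarith [ht.2]) h5.1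
    rw [(gameSeq_nonpos_of_le_threshold hp le_rfl _).1] at h6
    linarith [(abs_le.mp h4).2]
  refine le_of_tendsto ?_ hev
  have : Tendsto (fun p => -((limitDeriv threshold + 1) * (p - threshold))) (𝓝 threshold)
      (𝓝 (-((limitDeriv threshold + 1) * (threshold - threshold)))) :=
    (Continuous.tendsto (by fun_prop) _)
  simp only [sub_self, mul_zero, neg_zero] at this
  exact this.mono_left nhdsWithin_le_nhds

/-! ### Asymptotics of the linear recursion at the threshold -/

/-- The difference a - G is nondecreasing from n on and tends to 0. This replaces the summation of
tails. -/
lemma le_of_forall_sub_succ_le {a G : ℕ → ℝ} {n : ℕ}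
    (h : ∀ k ≥ n, a k - a (k + 1) ≤ G k - G (k + 1)) (ha : Tendsto a atTop (𝓝 0))
    (hG : Tendsto G atTop (𝓝 0)) : a n ≤ G n := by
  have h1 : ∀ m ≥ n, a n - G n ≤ a m - G m := by
    intro m hm
    induction m, hm using Nat.le_induction with
    | base => exact le_rfl
    | succ m hm ih => linarith [h m hm]
  have h2 : Tendsto (fun m => a m - G m) atTop (𝓝 0) := by simpa using ha.sub hG
  linarith [ge_of_tendsto h2 (eventually_atTop.mpr ⟨n, h1⟩)]

/-- A bound for the sum of the tail of the series of `(k + 2) * p ^ (k + 1) * (1 - p)`. -/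
noncomputable def tailBound (p : ℝ) (k : ℕ) : ℝ := 3 * (k + 5) * p ^ (k + 1)

lemma tailBound_sub_succ_ge {p : ℝ} (h0 : 0 ≤ p) (h1 : p ≤ 14 / 25) (k : ℕ) :
    (k + 3) * p ^ (k + 1) ≤ tailBound p k - tailBound p (k + 1) := by
  have e : tailBound p k - tailBound p (k + 1)
      = 3 * ((k + 5) - (k + 6) * p) * p ^ (k + 1) := by
    simp only [tailBound]; push_cast; ring
  rw [e]
  gcongr
  have : (0 : ℝ) ≤ k := Nat.cast_nonneg k
  nlinarith

lemma tailBound_nonneg {p : ℝ} (h0 : 0 ≤ p) (k : ℕ) : 0 ≤ tailBound p k := by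
  unfold tailBound; positivity

lemma tailBound_le_of_le {p p' : ℝ} (h0 : 0 ≤ p) (h : p ≤ p') (k : ℕ) :
    tailBound p k ≤ tailBound p' k := by
  unfold tailBound; gcongr

lemma tendsto_mul_tailBound {p : ℝ} (h0 : 0 ≤ p) (h1 : p < 1) :
    Tendsto (fun k : ℕ => ((k : ℝ) + 3) * tailBound p k) atTop (𝓝 0) := by
  have h := fun m => tendsto_pow_const_mul_const_pow_of_lt_one m h0 h1
  have := (((h 2).const_mul (3 * p)).add ((h 1).const_mul (24 * p))).add ((h 0).const_mul (45 * p))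
  simp only [mul_zero, add_zero] at this
  refine this.congr fun k => ?_
  simp only [tailBound]
  ring

lemma tendsto_tailBound {p : ℝ} (h0 : 0 ≤ p) (h1 : p < 1) :
    Tendsto (tailBound p) atTop (𝓝 0) :=
  squeeze_zero (tailBound_nonneg h0) (fun k => le_mul_of_one_le_left (tailBound_nonneg h0 k)
    (by linarith [(Nat.cast_nonneg k : (0 : ℝ) ≤ k)])) (tendsto_mul_tailBound h0 h1)

lemma tendsto_neg_linSeq_threshold :
    Tendsto (fun k => -linSeq threshold k) atTop (𝓝 0) := by
  have ht := threshold_mem_Ioo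
  have hp : 0 ≤ threshold := by linarith [ht.1]
  have hlim := (tendsto_gameSeq threshold_mem.1 (by linarith [ht.2])).neg
  rw [limitValue_threshold, neg_zero] at hlim
  refine hlim.congr fun k => ?_
  rw [(gameSeq_nonpos_of_le_threshold hp le_rfl k).1]

lemma neg_linSeq_sub_succ (p : ℝ) (k : ℕ) :
    -linSeq p k - -linSeq p (k + 1)
      = p ^ (k + 2) * (1 - p) - (1 - p) ^ (k + 2) + almostAll p (k + 2) * -linSeq p k := by
  simp only [linSeq]; ring

/-- A crude bound, enough to make `almostAll` times `linSeq` negligible against p^(k+2). -/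
lemma neg_linSeq_threshold_le (k : ℕ) : -linSeq threshold k ≤ tailBound threshold k := by
  have ht := threshold_mem_Ioo
  have hp : 0 ≤ threshold := by linarith [ht.1]
  have hq : 0 ≤ 1 - threshold := by linarith [ht.2]
  refine le_of_forall_sub_succ_le (a := fun k => -linSeq threshold k) (fun k _ => ?_)
    tendsto_neg_linSeq_threshold (tendsto_tailBound hp (by linarith [ht.2]))
  refine le_trans ?_ (tailBound_sub_succ_ge hp (by linarith [ht.2]) k)
  have h1 := (abs_le.mp (abs_linSeq_le_one threshold_mem.1 (by linarith [ht.2]) k)).1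
  have h2 : almostAll threshold (k + 2) * -linSeq threshold k ≤ almostAll threshold (k + 2) * 1 :=
    mul_le_mul_of_nonneg_left (by linarith) (almostAll_nonneg hp (by linarith) _)
  have h3 : 0 ≤ (1 - threshold) ^ (k + 2) := by positivity
  have h4 : threshold ^ (k + 2) * (1 - threshold) + almostAll threshold (k + 2)
      ≤ (k + 3) * threshold ^ (k + 1) := by
    have : threshold ^ (k + 2) * (1 - threshold) + almostAll threshold (k + 2)
      = (threshold * (1 - threshold) + threshold + (k + 2) * (1 - threshold))
        * threshold ^ (k + 1) := by
      rw [almostAll_succ]; push_cast; ring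
    rw [this]
    refine mul_le_mul_of_nonneg_right ?_ (by positivity)
    have : (0 : ℝ) ≤ k := Nat.cast_nonneg k
    nlinarith
  simp only [neg_linSeq_sub_succ]
  linarith

/-- The decrements are (1 - p) p^(k+2), exactly those of p^(k+2), up to two terms that are
o(p^(k+2)). -/
lemma eventually_neg_linSeq_threshold {ε : ℝ} (hε : 0 < ε) :
    ∀ᶠ k in atTop, (1 - ε) * threshold ^ (k + 2) ≤ -linSeq threshold k ∧
      -linSeq threshold k ≤ (1 + ε) * threshold ^ (k + 2) := by
  have ht := threshold_mem_Ioo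
  have hp : 0 < threshold := by linarith [ht.1]
  have hq : 0 < 1 - threshold := by linarith [ht.2]
  set p := threshold with hpdef
  have h1 := (tendsto_mul_tailBound hp.le (by linarith [ht.2])).const_mul (1 / p)
  have h2 := (tendsto_pow_atTop_nhds_zero_of_lt_one (r := (1 - p) / p) (by positivity)
    ((div_lt_one hp).mpr (by linarith [ht.1])))
  rw [mul_zero] at h1
  have hε' : 0 < ε * (1 - p) := by positivity
  obtain ⟨K, hK⟩ := eventually_atTop.mp
    ((h1.eventually_lt_const hε').and (h2.eventually_lt_const hε'))
  have hpow : ∀ C : ℝ, Tendsto (fun k : ℕ => C * p ^ (k + 2)) atTop (𝓝 0) := by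
    intro C
    have := ((tendsto_add_atTop_iff_nat 2).mpr
      (tendsto_pow_atTop_nhds_zero_of_lt_one hp.le (by linarith [ht.2]))).const_mul C
    rwa [mul_zero] at this
  have key : ∀ k ≥ K, 0 ≤ almostAll p (k + 2) * -linSeq p k ∧
      almostAll p (k + 2) * -linSeq p k ≤ ε * (1 - p) * p ^ (k + 2) ∧
      0 ≤ (1 - p) ^ (k + 2) ∧ (1 - p) ^ (k + 2) ≤ ε * (1 - p) * p ^ (k + 2) := by
    intro k hk
    have hA := almostAll_nonneg hp.le (by linarith [ht.2]) (k + 2)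
    have hl : 0 ≤ -linSeq p k := neg_nonneg.mpr (linSeq_threshold_nonpos k)
    refine ⟨by positivity, ?_, by positivity, ?_⟩
    · have e : almostAll p (k + 2) ≤ 1 / p * (k + 3) * p ^ (k + 2) := by
        rw [almostAll_succ]
        push_cast
        have : 1 / p * (k + 3) * p ^ (k + 2) = (k + 3) * p ^ (k + 1) := by field_simp; ring
        rw [this]
        have : p ^ (k + 2) + (k + 1 + 1) * p ^ (k + 1) * (1 - p)
          = (p + (k + 2) * (1 - p)) * p ^ (k + 1) := by ring
        rw [show k + 1 + 1 = k + 2 by ring, this]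
        refine mul_le_mul_of_nonneg_right ?_ (by positivity)
        have : (0 : ℝ) ≤ k := Nat.cast_nonneg k
        nlinarith
      calc almostAll p (k + 2) * -linSeq p k
          ≤ 1 / p * (k + 3) * p ^ (k + 2) * tailBound p k :=
            mul_le_mul e (neg_linSeq_threshold_le k) hl (by positivity)
        _ = (1 / p * ((k + 3) * tailBound p k)) * p ^ (k + 2) := by ring
        _ ≤ ε * (1 - p) * p ^ (k + 2) :=
            mul_le_mul_of_nonneg_right (hK k hk).1.le (by positivity)
    · have h3 := (hK (k + 2) (by omega)).2
      rw [div_pow, div_lt_iff₀ (by positivity)] at h3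
      exact h3.le
  refine eventually_atTop.mpr ⟨K, fun k hk => ⟨?_, ?_⟩⟩
  · refine le_of_forall_sub_succ_le (a := fun k => (1 - ε) * p ^ (k + 2))
      (G := fun k => -linSeq p k) (fun j hj => ?_) (hpow _) tendsto_neg_linSeq_threshold
    obtain ⟨a, b, c, d⟩ := key j (hk.trans hj)
    simp only [neg_linSeq_sub_succ]
    have : (1 - ε) * p ^ (j + 2) - (1 - ε) * p ^ (j + 1 + 2)
      = p ^ (j + 2) * (1 - p) - ε * (1 - p) * p ^ (j + 2) := by ring
    linarith
  · refine le_of_forall_sub_succ_le (a := fun k => -linSeq p k)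
      (G := fun k => (1 + ε) * p ^ (k + 2)) (fun j hj => ?_) tendsto_neg_linSeq_threshold (hpow _)
    obtain ⟨a, b, c, d⟩ := key j (hk.trans hj)
    simp only [neg_linSeq_sub_succ]
    have : (1 + ε) * p ^ (j + 2) - (1 + ε) * p ^ (j + 1 + 2)
      = p ^ (j + 2) * (1 - p) + ε * (1 - p) * p ^ (j + 2) := by ring
    linarith

/-! ### The derivative of the limit -/

lemma gameSeq_sub_linSeq_le {p : ℝ} (h : threshold < p) (h1 : p ≤ 14 / 25) (k : ℕ) :
    gameSeq p k - linSeq p k ≤ tailBound p (crossing p) * limitValue p := by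
  have hp : 0 ≤ p := by linarith [threshold_mem_Ioo.1]
  have hq : 0 ≤ 1 - p := by linarith
  have hhalf : 1 / 2 ≤ p := threshold_mem.1.trans h.le
  have hc := crossing_spec h (by linarith)
  have hs : 0 ≤ limitValue p := hc.2.trans (gameSeq_le_limitValue hhalf (by linarith) hc.1)
  rcases Nat.lt_or_ge k (crossing p) with hk | hk
  · rw [gameSeq_eq_linSeq_of_le_crossing hk.le, sub_self]
    exact mul_nonneg (tailBound_nonneg hp _) hs
  -- The added term turns the left side into a nonincreasing quantity from the crossing on.
  suffices gameSeq p k - linSeq p k + tailBound p k * limitValue p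
      ≤ tailBound p (crossing p) * limitValue p by
    have := mul_nonneg (tailBound_nonneg hp k) hs
    linarith
  induction k, hk using Nat.le_induction with
  | base => rw [gameSeq_eq_linSeq_of_le_crossing le_rfl]; simp
  | succ k hk ih =>
    refine le_trans ?_ ih
    have h2 := gameSeq_nonneg_of_crossing_le h (by linarith) hk
    have h3 := gameSeq_le_limitValue hhalf (by linarith) (hc.1.trans hk)
    rw [gameSeq_succ_sub, max_eq_left h2]
    have h4 : 0 ≤ almostAll p (k + 2) * (gameSeq p k - linSeq p k) :=
      mul_nonneg (almostAll_nonneg hp (by linarith) _)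
        (sub_nonneg.mpr (linSeq_le_gameSeq hp (by linarith) k))
    have h5 : (k + 2) * p ^ (k + 1) * (1 - p) ≤ (k + 3) * p ^ (k + 1) := by
      have : (k + 2) * p ^ (k + 1) * (1 - p) = (k + 2) * (1 - p) * p ^ (k + 1) := by ring
      rw [this]
      gcongr
      have : (0 : ℝ) ≤ k := Nat.cast_nonneg k
      nlinarith
    have h6 : (k + 2) * p ^ (k + 1) * (1 - p) * gameSeq p k
        ≤ (tailBound p k - tailBound p (k + 1)) * limitValue p :=
      mul_le_mul (h5.trans (tailBound_sub_succ_ge hp h1 k)) h3 h2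
        (le_trans (by positivity) (tailBound_sub_succ_ge hp h1 k))
    linarith

lemma hasDerivAt_limitValue : HasDerivAt limitValue (limitDeriv threshold) threshold := by
  have ht := threshold_mem_Ioo
  have hc := limitDeriv_threshold_ge
  set c := limitDeriv threshold
  have hlow : ∀ k, gameSeq threshold k = linSeq threshold k := fun k =>
    (gameSeq_nonpos_of_le_threshold (by linarith [ht.1]) le_rfl k).1
  have hlim0 := tendsto_gameSeq threshold_mem.1 (by linarith [ht.2])
  rw [hasDerivAt_iff_isLittleO, Asymptotics.isLittleO_iff]
  intro ε' hε'
  set ε := min 1 (ε' / 2) with hεdef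
  have hε : 0 < ε := lt_min one_pos (half_pos hε')
  have hε1 : ε ≤ 1 := min_le_left _ _
  have hε2 : ε ≤ ε' / 2 := min_le_right _ _
  obtain ⟨δ, hδ, K, hK⟩ := exists_abs_linSeq_sub_le hε
  set η := min (1 / 2) (ε / (2 * (c + 1))) with hηdef
  have hη : 0 < η := lt_min (by norm_num) (by positivity)
  have hη1 : η ≤ 1 / 2 := min_le_left _ _
  have hη2 : η * (2 * (c + 1)) ≤ ε := (le_div_iff₀ (by positivity)).mp (min_le_right _ _)
  have hright : ∀ᶠ p in 𝓝[>] threshold, tailBound (14 / 25) (crossing p) < η :=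
    (((tendsto_tailBound (by norm_num) (by norm_num)).comp tendsto_crossing).eventually_lt_const hη)
  rw [eventually_nhdsWithin_iff] at hright
  filter_upwards [hright, Metric.ball_mem_nhds threshold hδ,
    Ioo_mem_nhds (show 1 / 2 < threshold by linarith [ht.1])
      (show threshold < 14 / 25 by linarith [ht.2])] with p h1 h2 h3
  rw [limitValue_threshold, sub_zero, smul_eq_mul, Real.norm_eq_abs, Real.norm_eq_abs]
  have hKp := fun k hk => hK k hk p (by simpa [Real.dist_eq] using h2)
  have hlim := ((tendsto_gameSeq h3.1.le (by linarith [h3.2])).sub hlim0).sub_const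
    ((p - threshold) * c)
  rw [limitValue_threshold, sub_zero] at hlim
  have habs := abs_nonneg (p - threshold)
  rcases le_or_gt p threshold with hle | hgt
  · refine le_of_tendsto hlim.abs (eventually_atTop.mpr ⟨K, fun k hk => ?_⟩)
    rw [hlow, (gameSeq_nonpos_of_le_threshold (by linarith [h3.1]) hle k).1, mul_comm _ c]
    refine (hKp k hk).trans ?_
    gcongr
    linarith
  · have hcr := crossing_spec hgt (by linarith [h3.2])
    have hs : 0 ≤ limitValue p :=
      hcr.2.trans (gameSeq_le_limitValue h3.1.le (by linarith [h3.2]) hcr.1)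
    have htb : tailBound p (crossing p) ≤ η :=
      (tailBound_le_of_le (by linarith [h3.1]) h3.2.le _).trans (h1 hgt).le
    have hmain : |limitValue p - (p - threshold) * c|
        ≤ ε * |p - threshold| + η * limitValue p := by
      refine le_of_tendsto hlim.abs (eventually_atTop.mpr ⟨K, fun k hk => ?_⟩)
      have a1 := gameSeq_sub_linSeq_le hgt h3.2.le k
      have a2 := linSeq_le_gameSeq (show 0 ≤ p by linarith [h3.1]) (by linarith [h3.2]) k
      have a3 : tailBound p (crossing p) * limitValue p ≤ η * limitValue p := by gcongr
      have a4 : gameSeq p k - gameSeq threshold k - (p - threshold) * c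
          = (linSeq p k - linSeq threshold k - c * (p - threshold))
            + (gameSeq p k - linSeq p k) := by rw [hlow]; ring
      rw [a4]
      refine (abs_add_le _ _).trans (add_le_add (hKp k hk) ?_)
      rw [abs_of_nonneg (by linarith)]
      linarith
    rw [abs_of_pos (show 0 < p - threshold by linarith)] at *
    -- As η ≤ 1/2, the term η * `limitValue p` can be absorbed on the left; this a priori bound then
    -- makes that term at most ε * (p - `threshold`).
    have b1 : limitValue p ≤ 2 * (c + 1) * (p - threshold) := by
      have := (abs_le.mp hmain).2
      nlinarith
    have b2 : η * limitValue p ≤ η * (2 * (c + 1) * (p - threshold)) := by gcongr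
    have b3 : η * (2 * (c + 1)) * (p - threshold) ≤ ε * (p - threshold) := by gcongr
    have b4 : ε * (p - threshold) ≤ ε' / 2 * (p - threshold) := by gcongr
    linarith

/-! ### The logarithmic formula -/

/-- The quantity whose integer part is, up to a vanishing error, the number of coins up to which B
is best. -/
noncomputable def logRatio (p : ℝ) : ℝ :=
  (Real.log (p - threshold) + Real.log (limitDeriv threshold)) / Real.log threshold

lemma eventually_logRatio {η : ℝ} (hη : 0 < η) :
    ∀ᶠ p in 𝓝[>] threshold, (crossing p + 1 : ℝ) - η ≤ logRatio p ∧
      logRatio p ≤ (crossing p + 1 : ℝ) + 1 + η := by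
  have ht := threshold_mem_Ioo
  have hp : 0 < threshold := by linarith [ht.1]
  have hc := limitDeriv_threshold_ge
  set c := limitDeriv threshold with hcdef
  have hlog : Real.log threshold < 0 := Real.log_neg hp (by linarith [ht.2])
  -- Two factors θ = exp(-μ), one from the relative errors on each side, change the logarithmic
  -- quotient by exactly η.
  set μ := η * (-Real.log threshold) / 2 with hμ
  have hμ0 : 0 < μ := by have : 0 < -Real.log threshold := by linarith
                         positivity
  set θ := Real.exp (-μ) with hθ
  have hθ0 : 0 < θ := Real.exp_pos _
  have hθ1 : θ < 1 := by
    rw [hθ, ← Real.exp_zero]; exact Real.exp_lt_exp.mpr (by linarith)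
  have hθl : Real.log θ = -μ := Real.log_exp _
  obtain ⟨δ, hδ, K, hK⟩ := exists_abs_linSeq_sub_le (show 0 < (1 - θ) * c by
    have : 0 < 1 - θ := by linarith
    positivity)
  obtain ⟨K', hK'⟩ := eventually_atTop.mp (eventually_neg_linSeq_threshold
    (show 0 < 1 - θ by linarith))
  filter_upwards [tendsto_crossing.eventually_ge_atTop (K + K' + 2), eventually_mem_Ioo,
    Ioo_mem_nhdsGT (show threshold < threshold + δ by linarith)] with p h1 h2 h3
  have hpos : 0 < p - threshold := by linarith [h2.1]
  have hKp := fun k hk => hK k hk p (by rw [abs_of_pos hpos]; linarith [h3.2])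
  rw [abs_of_pos hpos] at hKp
  obtain ⟨k, hk⟩ := Nat.exists_eq_add_of_le' (show 1 ≤ crossing p by omega)
  -- Lets 2 - θ = 1 + (1 - θ) be replaced by 1/θ.
  have hθθ : θ * (2 - θ) ≤ 1 := by nlinarith [sq_nonneg (1 - θ)]
  have hneg := gameSeq_neg_of_lt_crossing (p := p) (k := k) (by omega) (by omega)
  have hnn := (crossing_spec h2.1 (by linarith [h2.2])).2
  rw [gameSeq_eq_linSeq_of_le_crossing (by omega)] at hneg hnn
  rw [hk] at hnn ⊢
  have u1 := abs_le.mp (hKp k (by omega))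
  have u2 := abs_le.mp (hKp (k + 1) (by omega))
  have v1 := (hK' k (by omega)).2
  have v2 := (hK' (k + 1) (by omega)).1
  have hx : 0 < c * (p - threshold) := by positivity
  have hlogx : Real.log (p - threshold) + Real.log c = Real.log (c * (p - threshold)) := by
    rw [Real.log_mul (by positivity) (by positivity), add_comm]
  have w1 : θ * (c * (p - threshold)) ≤ (2 - θ) * threshold ^ (k + 2) := by linarith [u1.1]
  have w2 : θ * threshold ^ (k + 3) ≤ (2 - θ) * (c * (p - threshold)) := by
    rw [show k + 3 = k + 1 + 2 by ring]; linarith [u2.2]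
  have x1 : θ * (θ * (c * (p - threshold))) ≤ threshold ^ (k + 2) := by
    have : 0 < threshold ^ (k + 2) := by positivity
    have := mul_le_mul_of_nonneg_left w1 hθ0.le
    nlinarith
  have x2 : θ * (θ * threshold ^ (k + 3)) ≤ c * (p - threshold) := by
    have := mul_le_mul_of_nonneg_left w2 hθ0.le
    nlinarith
  have y1 := Real.log_le_log (by positivity) x1
  have y2 := Real.log_le_log (by positivity) x2
  rw [Real.log_mul (by positivity) (by positivity), Real.log_mul (by positivity) (by positivity),
    Real.log_pow, hθl] at y1 y2
  rw [logRatio, hlogx, le_div_iff_of_neg hlog, div_le_iff_of_neg hlog]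
  push_cast at y1 y2 ⊢
  constructor <;> linarith

/-- The error term that makes the integer part of `logRatio` exact. -/
noncomputable def logError (p : ℝ) : ℝ :=
  if logRatio p < crossing p + 1 then (crossing p + 1) - logRatio p
  else if (crossing p + 1 : ℝ) + 1 ≤ logRatio p then
    (crossing p + 1 + 1) - logRatio p - (p - threshold)
  else 0

/-- After an overshoot the sum is placed p - `threshold` below the next integer, since the floor
needs a strict inequality there. -/
lemma floor_logRatio_add_logError {p : ℝ} (h : threshold < p) (h1 : p ≤ 2 / 3) :
    ((crossing p + 1 : ℕ) : ℤ) = ⌊logRatio p + logError p⌋ := by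
  have ht := threshold_mem_Ioo
  symm
  rw [Int.floor_eq_iff]
  push_cast
  unfold logError
  split_ifs with c1 c2
  · constructor <;> linarith
  · constructor <;> linarith [ht.1]
  · constructor <;> linarith

lemma tendsto_logError : Tendsto logError (𝓝[>] threshold) (𝓝 0) := by
  rw [Metric.tendsto_nhds]
  intro ε hε
  filter_upwards [eventually_logRatio (show 0 < ε / 3 by positivity),
    Ioo_mem_nhdsGT (show threshold < threshold + ε / 3 by linarith)] with p h1 h2
  rw [Real.dist_eq, sub_zero, abs_lt]
  unfold logError
  split_ifs with c1 c2
  · constructor <;> linarith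
  · constructor <;> linarith [h2.1, h2.2]
  · constructor <;> linarith

/-! ### The golden ratio and the three ranges of p -/

lemma gameSeq_one_nonneg {p : ℝ} (h : (Real.sqrt 5 - 1) / 2 ≤ p) (h1 : p < 1) :
    0 ≤ gameSeq p 1 := by
  have h5 := Real.sq_sqrt (show (0 : ℝ) ≤ 5 by norm_num)
  have h0 := Real.sqrt_nonneg 5
  rw [gameSeq_one]
  refine mul_nonneg (by linarith) ?_
  nlinarith

lemma gameSeq_one_neg {p : ℝ} (h0 : 0 ≤ p) (h : p < (Real.sqrt 5 - 1) / 2) (h1 : p < 1) :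
    gameSeq p 1 < 0 := by
  have h5 := Real.sq_sqrt (show (0 : ℝ) ≤ 5 by norm_num)
  rw [gameSeq_one]
  refine mul_neg_of_pos_of_neg (by linarith) ?_
  nlinarith [Real.sqrt_nonneg 5]

lemma half_le_phi : 1 / 2 ≤ (Real.sqrt 5 - 1) / 2 := by
  have := Real.le_sqrt_of_sq_le (show (2 : ℝ) ^ 2 ≤ 5 by norm_num)
  linarith

lemma phi_lt_two_thirds : (Real.sqrt 5 - 1) / 2 < 2 / 3 := by
  have := (Real.sqrt_lt' (show (0 : ℝ) < 7 / 3 by norm_num)).mpr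
    (show (5 : ℝ) < (7 / 3) ^ 2 by norm_num)
  linarith

lemma ruleA_goodAt_of_phi_le {p : ℝ} (h : (Real.sqrt 5 - 1) / 2 ≤ p) (h1 : p < 1) (n : ℕ) :
    GoodAt p ruleA n := by
  apply ruleA_goodAt
  match n with
  | 0 => exact Or.inl rfl
  | 1 => exact Or.inr le_rfl
  | k + 2 =>
    exact Or.inr ((gameSeq_one_nonneg h h1).trans
      (gameSeq_mono (half_le_phi.trans h) h1 (Nat.zero_le k)))

lemma ruleB_goodAt_of_le_threshold {p : ℝ} (h0 : 0 ≤ p) (h : p ≤ threshold) (n : ℕ) :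
    GoodAt p ruleB n := by
  apply ruleB_goodAt
  cases n with
  | zero => exact Or.inl rfl
  | succ k => exact Or.inr (gameSeq_nonpos_of_le_threshold h0 h k).2

/-- With n + 1 coins the sign of `gameSeq p (n - 1)` matters, so the last round for B has `crossing
p + 1` coins. -/
lemma switchRule_goodAt {p : ℝ} (h : threshold < p) (h1 : p ≤ 2 / 3) (n : ℕ) :
    GoodAt p (switchRule (crossing p + 1)) n := by
  rcases Nat.lt_or_ge (crossing p + 1) (n + 1) with hn | hn
  · refine goodAt_congr (R := ruleA) (by funext H D; simp [switchRule, hn]) (ruleA_goodAt ?_)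
    obtain ⟨k, rfl⟩ := Nat.exists_eq_add_of_le' (show 1 ≤ n by omega)
    exact Or.inr (gameSeq_nonneg_of_crossing_le h h1 (by omega))
  · refine goodAt_congr (R := ruleB) (by funext H D; simp [switchRule, hn.not_gt])
      (ruleB_goodAt ?_)
    match n with
    | 0 => exact Or.inl rfl
    | 1 => exact Or.inr le_rfl
    | k + 2 => exact Or.inr (gameSeq_neg_of_lt_crossing (by omega) (by omega)).le

lemma two_le_crossing {p : ℝ} (h : threshold < p) (h1 : p < (Real.sqrt 5 - 1) / 2) :
    2 ≤ crossing p := by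
  have h2 := phi_lt_two_thirds
  have hc := crossing_spec h (by linarith)
  by_contra! hlt
  have h3 : crossing p = 1 := by omega
  rw [h3] at hc
  exact absurd (gameSeq_one_neg (by linarith [threshold_mem_Ioo.1]) h1 (by linarith))
    (not_lt.mpr hc.2)

end CoinGame

open CoinGame in
theorem mainTheorem1 :
    (∀ p : ℝ, 1 / 2 ≤ p → p < 1 → ∀ n : ℕ, 3 ≤ n →
      OptimalDecision p n ruleA ∨ OptimalDecision p n ruleB) ∧
    ∃ (p₀ c : ℝ) (s : ℝ → ℝ) (N : ℝ → ℕ) (e : ℝ → ℝ),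
      |p₀ - 0.5495021777642| < 10 ^ (-14 : ℤ) ∧
      (∀ p : ℝ, 1 / 2 ≤ p → p < 1 → Tendsto (fun n : ℕ => sSeq n p) atTop (𝓝 (s p))) ∧
      HasDerivAt s c p₀ ∧
      0 < c ∧
      -- First possibility
      (∀ p : ℝ, (Real.sqrt 5 - 1) / 2 ≤ p → p < 1 → ∀ n : ℕ, 3 ≤ n →
        OptimalToFollow p n ruleA) ∧
      -- Second possibility
      (∀ p : ℝ, p₀ < p → p < (Real.sqrt 5 - 1) / 2 →
        3 ≤ N p ∧
        (∀ n : ℕ, 3 ≤ n → OptimalToFollow p n (switchRule (N p))) ∧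
        (∀ n : ℕ, 3 ≤ n → n ≤ N p → ¬ OptimalDecision p n ruleA) ∧
        (N p : ℤ) = ⌊(Real.log (p - p₀) + Real.log c) / Real.log p₀ + e p⌋) ∧
      Tendsto e (𝓝[>] p₀) (𝓝 0) ∧
      Tendsto N (𝓝[>] p₀) atTop ∧
      -- Third possibility
      (∀ p : ℝ, 1 / 2 ≤ p → p ≤ p₀ → ∀ n : ℕ, 3 ≤ n → OptimalToFollow p n ruleB) := by
  have ht := threshold_mem_Ioo
  have hφ := phi_lt_two_thirds
  refine ⟨fun p h1 h2 n _ => optimalDecision_ruleA_or_ruleB h1 h2 n,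
    threshold, limitDeriv threshold, limitValue, fun p => crossing p + 1, logError, ?_, ?_,
    hasDerivAt_limitValue, by linarith [limitDeriv_threshold_ge], ?_, ?_, tendsto_logError,
    (tendsto_add_atTop_nat 1).comp tendsto_crossing, ?_⟩
  · have h1 := lower_le_threshold
    have h2 := threshold_le_upper
    norm_num at h1 h2 ⊢
    rw [abs_lt]
    constructor <;> linarith
  · intro p h1 h2
    refine (tendsto_add_atTop_iff_nat 1).mp ?_
    simpa only [sSeq_succ h1 h2] using tendsto_gameSeq h1 h2
  · exact fun p h1 h2 n _ => optimalToFollow_of_goodAt (half_le_phi.trans h1) h2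
      (ruleA_goodAt_of_phi_le h1 h2) n
  · intro p h1 h2
    have hhalf : 1 / 2 ≤ p := threshold_mem.1.trans h1.le
    have hlt : p < 1 := by linarith
    have hcr := two_le_crossing h1 h2
    simp only
    refine ⟨by omega, fun n _ => optimalToFollow_of_goodAt hhalf hlt
      (switchRule_goodAt h1 (by linarith)) n, fun n hn hnN => ?_,
      floor_logRatio_add_logError h1 (by linarith)⟩
    obtain ⟨k, rfl⟩ := Nat.exists_eq_add_of_le' (show 2 ≤ n by omega)
    exact not_optimalDecision_ruleA hhalf hlt (n := k + 1) (by omega)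
      (gameSeq_neg_of_lt_crossing (p := p) (k := k) (by omega) (by omega))
  · exact fun p h1 h2 n _ => optimalToFollow_of_goodAt h1 (by linarith [ht.2])
      (ruleB_goodAt_of_le_threshold (by linarith) h2) n
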